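/- Let $d\ge 1$ and let $f:\mathbb{R}^d\to\mathbb{R}$ be twice differentiable, $\mu$-strongly convex with $\mu>0$, with $L$-Lipschitz gradient, $L>0$, and strongly self-concordant with constant $M>0$, i.e. $\nabla^2 f(y)-\nabla^2 f(x)\preceq M\|y-x\|_z\nabla^2 f(w)$ for all $x,y,z,w\in\mathbb{R}^d$, where $\|v\|_z:=\sqrt{v^\top\nabla^2 f(z)v}$. For symmetric matrices $A,G$ and $u\in\mathbb{R}^d$ put $$\mathrm{BFGS}(A,G,u):=G-\frac{Guu^\top G}{u^\top Gu}+\frac{Auu^\top A}{u^\top Au}\quad(u\neq 0),\qquad \mathrm{BFGS}(A,G,0):=G.$$ The randomized Sharpened-BFGS method starts from $x_0\in\mathbb{R}^d$ and $G_0=LI$ and performs, for $t=0,1,2,\dots$: $x_{t+1}=x_t-G_t^{-1}\nabla f(x_t)$; $s_t=x_{t+1}-x_t$; $J_t=\int_0^1\nabla^2 f(x_t+\tau s_t)\,d\tau$; $\bar G_t=\mathrm{BFGS}(J_t,G_t,s_t)$; $r_t=\|s_t\|_{x_t}$; $\hat G_t=(1+Mr_t/2)^2\bar G_t$; compute, from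 the information available before $\tilde u_t$ is drawn, an upper triangular $R_t$ with $\hat G_t^{-1}=R_t^\top R_t$; draw $\tilde u_t\sim\mathcal N(0,I_d)$ independently of the past (including $R_t$); $G_{t+1}=\mathrm{BFGS}(\nabla^2 f(x_{t+1}),\hat G_t,R_t^\top\tilde u_t)$. Let $\lambda_t:=\sqrt{\nabla f(x_t)^\top\nabla^2 f(x_t)^{-1}\nabla f(x_t)}$ and assume $$\lambda_0\le\frac{\ln 2}{20}\cdot\frac{\mu}{dML}.$$ **Theorem.** The superlinear bound $$\lambda_t\le 2\Bigl(1-\frac1{2d}\Bigr)^{\frac{t(t-1)}4}\Bigl(\frac{8dL}{t\mu}\Bigr)^{\frac t2}\lambda_0 \qquad(*)$$ holds with high probability simultaneously for all $t\ge1$, in the following sense. 1. With probability at least $1-\dfrac{1+\ln(L/\mu)}{10\,L/\mu}$ (which is always at least $9/10$ and tends to $1$ as $L/\mu\to\infty$), $(*)$ holds for all $t\ge 1$. 2. For every $\delta\in(0,1)$, with probability at least $1-\delta$, both of the following hold: for all $t\ge1$, $$\lambda_t\le 2\Bigl(1-\frac1{2d}\Bigr)^{\frac{t(t-1)}4}\Bigl(\frac{8dL}{\delta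 t\mu}\Bigr)^{\frac t2}\lambda_0,$$ and $(*)$ holds for all $t\ge 1+4d\ln(1/\delta)$. -/

import Mathlib

open MeasureTheory ProbabilityTheory Matrix

namespace SharpenedBFGS

noncomputable section

/-- The Euclidean space `ℝ^d`. -/
abbrev Vec (d : ℕ) : Type := EuclideanSpace ℝ (Fin d)

/-- Real `d × d` matrices. -/
abbrev Mat (d : ℕ) : Type := Matrix (Fin d) (Fin d) ℝ

/-- The Hessian matrix `∇²f(x)`, with entries `D²f(x)[e_i, e_j]`. -/
def hess {d : ℕ} (f : Vec d → ℝ) (x : Vec d) : Mat d :=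
  Matrix.of fun i j =>
    fderiv ℝ (fderiv ℝ f) x (EuclideanSpace.single i 1) (EuclideanSpace.single j 1)

/-- The coordinate vector of the gradient `∇f(x)`. -/
def grad {d : ℕ} (f : Vec d → ℝ) (x : Vec d) : Fin d → ℝ :=
  WithLp.ofLp (gradient f x)

/-- The local norm `‖v‖_z = √(vᵀ ∇²f(z) v)`. -/
def localNorm {d : ℕ} (f : Vec d → ℝ) (z v : Vec d) : ℝ :=
  Real.sqrt (WithLp.ofLp v ⬝ᵥ (hess f z *ᵥ WithLp.ofLp v))

/-- The Newton decrement `λ_f(x) = √(∇f(x)ᵀ ∇²f(x)⁻¹ ∇f(x))`. -/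
def newtonDecrement {d : ℕ} (f : Vec d → ℝ) (x : Vec d) : ℝ :=
  Real.sqrt (grad f x ⬝ᵥ ((hess f x)⁻¹ *ᵥ grad f x))

/-- `f` is twice differentiable, `μ`-strongly convex, and its gradient is `L`-Lipschitz. -/
structure StronglyConvexSmooth {d : ℕ} (f : Vec d → ℝ) (μ L : ℝ) : Prop where
  differentiable : Differentiable ℝ f
  differentiable_fderiv : Differentiable ℝ (fderiv ℝ f)
  strongConvexOn : StrongConvexOn Set.univ μ f
  lipschitz : ∀ x y : Vec d, ‖gradient f x - gradient f y‖ ≤ L * ‖x - y‖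

/-- `f` is strongly self-concordant with constant `M`:
`∇²f(y) - ∇²f(x) ≼ M ‖y - x‖_z ∇²f(w)` for all `x, y, z, w`. -/
def StronglySelfConcordant {d : ℕ} (f : Vec d → ℝ) (M : ℝ) : Prop :=
  ∀ x y z w : Vec d,
    ((M * localNorm f z (y - x)) • hess f w - (hess f y - hess f x)).PosSemidef

/-- The update `BFGS(A, G, u) = G - G u uᵀ G / (uᵀ G u) + A u uᵀ A / (uᵀ A u)`.
For `u = 0` both correction terms vanish and the value is `G`. -/
def bfgs {d : ℕ} (A G : Mat d) (u : Fin d → ℝ) : Mat d :=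
  G - (u ⬝ᵥ (G *ᵥ u))⁻¹ • (G * Matrix.vecMulVec u u * G)
    + (u ⬝ᵥ (A *ᵥ u))⁻¹ • (A * Matrix.vecMulVec u u * A)

/-- The averaged Hessian `∫₀¹ ∇²f(x + τ (y - x)) dτ`, entry by entry. -/
def avgHess {d : ℕ} (f : Vec d → ℝ) (x y : Vec d) : Mat d :=
  Matrix.of fun i j => ∫ τ in (0 : ℝ)..1, hess f (x + τ • (y - x)) i j

/-- The quasi-Newton step `x - G⁻¹ ∇f(x)` with unit step size. -/
def qnStep {d : ℕ} (f : Vec d → ℝ) (x : Vec d) (G : Mat d) : Vec d :=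
  x - WithLp.toLp 2 (G⁻¹ *ᵥ grad f x)

/-- The corrected matrix `Ĝ = (1 + M r / 2)² BFGS(J, G, s)`, where `y = x - G⁻¹ ∇f(x)` is the next
iterate, `s = y - x`, `J` is the averaged Hessian between `x` and `y`, and `r = ‖y - x‖_x`. -/
def corrected {d : ℕ} (f : Vec d → ℝ) (M : ℝ) (x : Vec d) (G : Mat d) : Mat d :=
  let y := qnStep f x G
  (1 + M * localNorm f x (y - x) / 2) ^ 2 • bfgs (avgHess f x y) G (WithLp.ofLp (y - x))

/-- A run of the randomized Sharpened-BFGS method on `(Ω, P)` started at `x₀` with `G₀ = L I`.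
`x t`, `G t` are the iterates and Hessian approximations, `R t` is the upper triangular factor with
`Ĝ_t⁻¹ = R_tᵀ R_t`, and `u t` is the Gaussian vector drawn in iteration `t`. `ℱ t` is the
information available before `u t` is drawn: `R t` is computed from it, `u t` is a fresh
`N(0, I_d)` sample independent of it, and `u t` is known from time `t + 1` on. -/
structure IsRandomizedRun {d : ℕ} {Ω : Type*} [mΩ : MeasurableSpace Ω] (P : Measure Ω)
    (f : Vec d → ℝ) (L M : ℝ) (x₀ : Vec d) (ℱ : Filtration ℕ mΩ)
    (x : ℕ → Ω → Vec d) (G R : ℕ → Ω → Mat d) (u : ℕ → Ω → Vec d) : Prop where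
  x_zero : ∀ ω, x 0 ω = x₀
  G_zero : ∀ ω, G 0 ω = L • (1 : Mat d)
  x_succ : ∀ t ω, x (t + 1) ω = qnStep f (x t ω) (G t ω)
  R_upper : ∀ t ω, (R t ω).IsUpperTriangular
  R_factor : ∀ t ω, (R t ω)ᵀ * R t ω = (corrected f M (x t ω) (G t ω))⁻¹
  R_measurable : ∀ t i j, Measurable[ℱ t] fun ω => R t ω i j
  u_measurable : ∀ t, Measurable[ℱ (t + 1)] (u t)
  u_law : ∀ t, P.map (u t) = stdGaussian (Vec d)
  u_indep : ∀ t, Indep (MeasurableSpace.comap (u t) inferInstance) (ℱ t) P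
  G_succ : ∀ t ω, G (t + 1) ω =
    bfgs (hess f (x (t + 1) ω)) (corrected f M (x t ω) (G t ω)) ((R t ω)ᵀ *ᵥ WithLp.ofLp (u t ω))

/-- The superlinear rate `2 (1 - 1/(2d))^{t(t-1)/4} (C d L / (t μ))^{t/2}`. -/
def rate (C : ℝ) (d : ℕ) (L μ : ℝ) (t : ℕ) : ℝ :=
  2 * (1 - 1 / (2 * (d : ℝ))) ^ ((t : ℝ) * ((t : ℝ) - 1) / 4) *
    (C * (d : ℝ) * L / ((t : ℝ) * μ)) ^ ((t : ℝ) / 2)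

end

end SharpenedBFGS

/-!
Write `H_t` for the Hessian at `x_t`, `κ = L / μ`, `ρ = 1 - 1 / (2 d)`, and let
`σ_t = tr (H_t⁻¹ G_t) - d` be the trace potential.

*Deterministic part.* Whatever the random directions are, `H_t ≼ G_t ≼ (5 / 4) κ H_t`: a BFGS
update towards `A` preserves all bounds `c A ≼ G ≼ η A` with `c ≤ 1 ≤ η`, and the correction
factor `(1 + M r_t / 2)²` makes up for the change of the Hessian along the step
(`corrected_bounds`). Hence the Newton decrement decreases linearly, the quantities `M r_t` are
summable, and by the smallness of `λ₀` their accumulated effect is at most `5 / 4`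
(`IsPath.invariant`, `inflation_le`). More precisely, `λ_{t+1} = (1 + e_t) θ_t λ_t` with a
summable deterministic error `e_t`, and the BFGS update along the step lowers the trace potential
by at least `θ_t²` up to an error proportional to `d M λ_t` (`exists_contraction`).

*Random part.* With `u = Rᵀ ũ` and `Ĝ⁻¹ = Rᵀ R`, the update along `u` replaces `tr (A⁻¹ Ĝ)` by
`tr (A⁻¹ Ĝ) + 1` minus the value of the quadratic form of `R⁻ᵀ A⁻¹ R⁻¹` at the direction
`ũ / ‖ũ‖`, whose mean is `tr (A⁻¹ Ĝ) / d`. So the trace potential contracts in expectation by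
exactly `1 - 1 / d`, which is at most `ρ²` (`integral_tracePotential_succ`). The additive error is
absorbed by working with `σ_t + 4 d M λ_t` (`drift_inequality`), and summing up gives
`∑ E θ_t² / ρ^(2 t) ≤ (5 / 4) d κ`. As the partial sums increase with `t`, Markov's inequality for
the infinite sum controls all of them at once: with probability at least `1 - δ` they are all at
most `(5 / 4) d κ / δ`.

*Conclusion.* On this event the arithmetic-geometric mean inequality gives
`λ_t ≤ 2 ρ^(t (t - 1) / 2) (5 d κ / (4 δ t))^(t / 2) λ₀`. This is the square of the claimed power
of `ρ`; the spare factor `(ρ^((t - 1) / 2))^(t / 2)` compensates for `1 / δ` as soon as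
`ρ^((t - 1) / 2) ≤ δ`. If `δ = (1 + ln κ) / (10 κ)`, then as long as `ρ^((t - 1) / 2) > 5 δ` the
claimed bound is at least `λ₀` and holds by monotonicity.
-/

/-! ### Loewner order and BFGS updates -/

namespace SharpenedBFGS

section MatrixAlgebra

variable {n : Type*} [Fintype n]

theorem dotProduct_mulVec_comm_of_isHermitian {A : Matrix n n ℝ} (hA : A.IsHermitian)
    (u v : n → ℝ) : u ⬝ᵥ (A *ᵥ v) = v ⬝ᵥ (A *ᵥ u) := by
  have h : Aᵀ = A := by simpa [Matrix.IsHermitian, conjTranspose_eq_transpose_of_trivial] using hA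
  rw [Matrix.dotProduct_mulVec, dotProduct_comm, ← Matrix.mulVec_transpose, h]

theorem PosDef.quadForm_pos {A : Matrix n n ℝ} (hA : A.PosDef) {v : n → ℝ} (hv : v ≠ 0) :
    0 < v ⬝ᵥ (A *ᵥ v) := by simpa using hA.dotProduct_mulVec_pos hv

theorem PosDef.quadForm_nonneg {A : Matrix n n ℝ} (hA : A.PosDef) (v : n → ℝ) :
    0 ≤ v ⬝ᵥ (A *ᵥ v) := by simpa using hA.posSemidef.dotProduct_mulVec_nonneg v

theorem quadForm_sub_smul {A : Matrix n n ℝ} (hA : A.IsHermitian) (u v : n → ℝ) (α : ℝ) :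
    (v - α • u) ⬝ᵥ (A *ᵥ (v - α • u))
      = v ⬝ᵥ (A *ᵥ v) - 2 * α * (u ⬝ᵥ (A *ᵥ v)) + α ^ 2 * (u ⬝ᵥ (A *ᵥ u)) := by
  simp only [mulVec_sub, mulVec_smul, sub_dotProduct, dotProduct_sub, smul_dotProduct,
    dotProduct_smul, smul_eq_mul, dotProduct_mulVec_comm_of_isHermitian hA v u]
  ring

/-- The value at `v` of the rank-one correction `B u uᵀ B` is the square of `uᵀ B v`. -/
theorem quadForm_mul_vecMulVec_mul {B : Matrix n n ℝ} (hB : B.IsHermitian) (u v : n → ℝ) :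
    v ⬝ᵥ ((B * vecMulVec u u * B) *ᵥ v) = (u ⬝ᵥ (B *ᵥ v)) ^ 2 := by
  rw [← mulVec_mulVec, ← mulVec_mulVec, vecMulVec_mulVec]
  simp only [mulVec_smul, dotProduct_smul, MulOpposite.smul_eq_mul_unop, MulOpposite.unop_op]
  rw [dotProduct_mulVec_comm_of_isHermitian hB v u]
  ring

theorem trace_mul_vecMulVec (X : Matrix n n ℝ) (u v : n → ℝ) :
    (X * vecMulVec u v).trace = v ⬝ᵥ (X *ᵥ u) := by
  rw [mul_vecMulVec, trace_vecMulVec, dotProduct_comm]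

theorem posSemidef_sub_of_quadForm_le {A B : Matrix n n ℝ} (hA : A.IsHermitian)
    (hB : B.IsHermitian) (h : ∀ v, v ⬝ᵥ (A *ᵥ v) ≤ v ⬝ᵥ (B *ᵥ v)) : (B - A).PosSemidef :=
  PosSemidef.of_dotProduct_mulVec_nonneg (hB.sub hA) fun v => by
    simpa [sub_mulVec, dotProduct_sub] using h v

variable [DecidableEq n]

theorem PosDef.inv_mul_cancel {A : Matrix n n ℝ} (hA : A.PosDef) : A⁻¹ * A = 1 :=
  nonsing_inv_mul _ ((Matrix.isUnit_iff_isUnit_det _).1 hA.isUnit)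

theorem PosDef.mul_inv_cancel {A : Matrix n n ℝ} (hA : A.PosDef) : A * A⁻¹ = 1 :=
  mul_nonsing_inv _ ((Matrix.isUnit_iff_isUnit_det _).1 hA.isUnit)

theorem PosDef.mulVec_inv_mulVec {A : Matrix n n ℝ} (hA : A.PosDef) (v : n → ℝ) :
    A *ᵥ (A⁻¹ *ᵥ v) = v := by rw [mulVec_mulVec, PosDef.mul_inv_cancel hA, one_mulVec]

/-- Inversion reverses the Loewner order: `A ≼ c B` implies `B⁻¹ ≼ c A⁻¹`. -/
theorem quadForm_inv_le {A B : Matrix n n ℝ} (hA : A.PosDef) (hB : B.PosDef) {c : ℝ} (hc : 0 < c)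
    (h : ∀ v, v ⬝ᵥ (A *ᵥ v) ≤ c * (v ⬝ᵥ (B *ᵥ v))) (v : n → ℝ) :
    v ⬝ᵥ (B⁻¹ *ᵥ v) ≤ c * (v ⬝ᵥ (A⁻¹ *ᵥ v)) := by
  -- `0 ≤ (w - α A⁻¹ v)ᵀ A (w - α A⁻¹ v)` with `w = B⁻¹ v` and `α = c`.
  set w := B⁻¹ *ᵥ v with hw
  set p := A⁻¹ *ᵥ v with hp
  have h1 := PosDef.quadForm_nonneg hA (w - c • p)
  rw [quadForm_sub_smul hA.1, dotProduct_mulVec_comm_of_isHermitian hA.1 p w, hp,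
    PosDef.mulVec_inv_mulVec hA, ← hp] at h1
  have h2 := h w
  rw [hw, PosDef.mulVec_inv_mulVec hB, ← hw] at h2
  rw [dotProduct_comm w v] at h1 h2
  rw [dotProduct_comm p v] at h1
  have h3 : 0 ≤ c * (c * (v ⬝ᵥ p) - v ⬝ᵥ w) := by nlinarith
  nlinarith [(mul_nonneg_iff_of_pos_left hc).1 h3]

open scoped MatrixOrder in
theorem PosSemidef.exists_eq_conjTranspose_mul_self {G : Matrix n n ℝ} (hG : G.PosSemidef) :
    ∃ C : Matrix n n ℝ, G = Cᴴ * C := by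
  obtain ⟨C, hC⟩ := CStarAlgebra.nonneg_iff_eq_star_mul_self.mp hG.nonneg
  exact ⟨C, hC⟩

theorem PosSemidef.trace_mul_nonneg {X G : Matrix n n ℝ} (hX : X.PosSemidef)
    (hG : G.PosSemidef) : 0 ≤ (X * G).trace := by
  obtain ⟨C, rfl⟩ := PosSemidef.exists_eq_conjTranspose_mul_self hG
  rw [← Matrix.mul_assoc, trace_mul_comm, ← Matrix.mul_assoc]
  exact (hX.mul_mul_conjTranspose_same C).trace_nonneg

theorem trace_inv_mul_le {A B G : Matrix n n ℝ} (hA : A.PosDef) (hB : B.PosDef)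
    (hG : G.PosSemidef) {c : ℝ} (hc : 0 < c)
    (h : ∀ v, v ⬝ᵥ (A *ᵥ v) ≤ c * (v ⬝ᵥ (B *ᵥ v))) :
    (B⁻¹ * G).trace ≤ c * (A⁻¹ * G).trace := by
  have h1 : (c • A⁻¹ - B⁻¹).PosSemidef := by
    refine posSemidef_sub_of_quadForm_le hB.inv.1 ((hA.inv.smul hc).1) fun v => ?_
    simpa [smul_mulVec, dotProduct_smul] using quadForm_inv_le hA hB hc h v
  have := PosSemidef.trace_mul_nonneg h1 hG
  rw [Matrix.sub_mul, trace_sub, Matrix.smul_mul, trace_smul, smul_eq_mul] at this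
  linarith

theorem card_le_trace_inv_mul {A G : Matrix n n ℝ} (hA : A.PosDef) (hG : G.IsHermitian)
    (h : ∀ v, v ⬝ᵥ (A *ᵥ v) ≤ v ⬝ᵥ (G *ᵥ v)) : (Fintype.card n : ℝ) ≤ (A⁻¹ * G).trace := by
  have := PosSemidef.trace_mul_nonneg hA.inv.posSemidef (posSemidef_sub_of_quadForm_le hA.1 hG h)
  rw [Matrix.mul_sub, trace_sub, PosDef.inv_mul_cancel hA, trace_one] at this
  linarith

theorem trace_inv_mul_le_card {A G : Matrix n n ℝ} (hA : A.PosDef) (hG : G.IsHermitian) {c : ℝ}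
    (h : ∀ v, v ⬝ᵥ (G *ᵥ v) ≤ c * (v ⬝ᵥ (A *ᵥ v))) :
    (A⁻¹ * G).trace ≤ c * Fintype.card n := by
  have hcA : (c • A).IsHermitian := by
    rw [Matrix.IsHermitian, conjTranspose_smul, hA.1]; simp
  have := PosSemidef.trace_mul_nonneg hA.inv.posSemidef
    (posSemidef_sub_of_quadForm_le hG hcA fun v => by
      simpa [smul_mulVec, dotProduct_smul] using h v)
  rw [Matrix.mul_sub, trace_sub, Matrix.mul_smul, trace_smul, PosDef.inv_mul_cancel hA,
    trace_one, smul_eq_mul] at this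
  linarith

theorem cauchy_schwarz_posDef {A : Matrix n n ℝ} (hA : A.PosDef) (u v : n → ℝ) :
    (u ⬝ᵥ v) ^ 2 ≤ (u ⬝ᵥ (A⁻¹ *ᵥ u)) * (v ⬝ᵥ (A *ᵥ v)) := by
  set w := A⁻¹ *ᵥ u with hw
  have hAw : A *ᵥ w = u := PosDef.mulVec_inv_mulVec hA u
  have hq := fun α : ℝ => PosDef.quadForm_nonneg hA (w - α • v)
  simp only [quadForm_sub_smul hA.1, hAw] at hq
  rw [dotProduct_comm w u, dotProduct_comm v u] at hq
  by_cases hv : v = 0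
  · simp [hv]
  have hpos := PosDef.quadForm_pos hA hv
  have := hq ((u ⬝ᵥ v) / (v ⬝ᵥ (A *ᵥ v)))
  field_simp at this
  linarith

/-- If `A ≼ G`, then every eigenvalue of `A⁻¹ G` is at most `1 + tr (A⁻¹ G) - n`. -/
theorem quadForm_le_trace_mul {A G : Matrix n n ℝ} (hA : A.PosDef) (hG : G.IsHermitian)
    (h : ∀ v, v ⬝ᵥ (A *ᵥ v) ≤ v ⬝ᵥ (G *ᵥ v)) (v : n → ℝ) :
    v ⬝ᵥ (G *ᵥ v) ≤ (1 + ((A⁻¹ * G).trace - Fintype.card n)) * (v ⬝ᵥ (A *ᵥ v)) := by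
  obtain ⟨C, hC⟩ := PosSemidef.exists_eq_conjTranspose_mul_self
    (posSemidef_sub_of_quadForm_le hA.1 hG h)
  have hG' : G = A + Cᵀ * C := by
    rw [← conjTranspose_eq_transpose_of_trivial, ← hC]; abel
  have h1 : (A⁻¹ * G).trace - Fintype.card n = ∑ i, C i ⬝ᵥ (A⁻¹ *ᵥ C i) := by
    rw [hG', Matrix.mul_add, trace_add, PosDef.inv_mul_cancel hA, trace_one,
      ← Matrix.mul_assoc, trace_mul_comm, ← Matrix.mul_assoc, add_sub_cancel_left]
    simp only [trace, diag, Matrix.mul_apply, dotProduct, mulVec, transpose_apply,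
      Finset.sum_mul, Finset.mul_sum, mul_assoc]
    exact Finset.sum_congr rfl fun i _ => Finset.sum_comm
  have h2 : v ⬝ᵥ (G *ᵥ v) = v ⬝ᵥ (A *ᵥ v) + ∑ i, (C i ⬝ᵥ v) ^ 2 := by
    rw [hG', add_mulVec, dotProduct_add, ← mulVec_mulVec, Matrix.dotProduct_mulVec v Cᵀ,
      vecMul_transpose]
    simp only [dotProduct, mulVec, sq]
  rw [h1, h2, add_mul, one_mul, Finset.sum_mul]
  gcongr with i
  exact cauchy_schwarz_posDef hA _ _

end MatrixAlgebra

section BFGS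

variable {d : ℕ}

theorem bfgs_zero (A G : Mat d) : bfgs A G 0 = G := by simp [bfgs]

theorem isHermitian_bfgs {A G : Mat d} (hA : A.IsHermitian) (hG : G.IsHermitian) (u : Fin d → ℝ) :
    (bfgs A G u).IsHermitian := by
  have hA' : Aᵀ = A := by simpa [Matrix.IsHermitian, conjTranspose_eq_transpose_of_trivial] using hA
  have hG' : Gᵀ = G := by simpa [Matrix.IsHermitian, conjTranspose_eq_transpose_of_trivial] using hG
  rw [Matrix.IsHermitian, conjTranspose_eq_transpose_of_trivial]
  simp only [bfgs, transpose_add, transpose_sub, transpose_smul, transpose_mul, hA', hG',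
    transpose_vecMulVec, Matrix.mul_assoc]

theorem quadForm_bfgs {A G : Mat d} (hA : A.IsHermitian) (hG : G.IsHermitian) (u v : Fin d → ℝ) :
    v ⬝ᵥ (bfgs A G u *ᵥ v) = v ⬝ᵥ (G *ᵥ v) - (u ⬝ᵥ (G *ᵥ v)) ^ 2 / (u ⬝ᵥ (G *ᵥ u))
      + (u ⬝ᵥ (A *ᵥ v)) ^ 2 / (u ⬝ᵥ (A *ᵥ u)) := by
  simp only [bfgs, add_mulVec, sub_mulVec, smul_mulVec, dotProduct_add, dotProduct_sub,
    dotProduct_smul, quadForm_mul_vecMulVec_mul hA, quadForm_mul_vecMulVec_mul hG, smul_eq_mul]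
  ring

/-- `vᵀ G v - (uᵀ G v)² / (uᵀ G u)` is the minimum over `α` of `(v - α u)ᵀ G (v - α u)`. -/
theorem quadForm_sub_sq_div_le {G : Mat d} (hG : G.PosDef) {u : Fin d → ℝ} (hu : u ≠ 0)
    (v : Fin d → ℝ) (α : ℝ) :
    v ⬝ᵥ (G *ᵥ v) - (u ⬝ᵥ (G *ᵥ v)) ^ 2 / (u ⬝ᵥ (G *ᵥ u))
      ≤ (v - α • u) ⬝ᵥ (G *ᵥ (v - α • u)) := by
  rw [quadForm_sub_smul hG.1]
  have hp := PosDef.quadForm_pos hG hu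
  have : 0 ≤ (α * (u ⬝ᵥ (G *ᵥ u)) - u ⬝ᵥ (G *ᵥ v)) ^ 2 / (u ⬝ᵥ (G *ᵥ u)) := by positivity
  have e : (α * (u ⬝ᵥ (G *ᵥ u)) - u ⬝ᵥ (G *ᵥ v)) ^ 2 / (u ⬝ᵥ (G *ᵥ u))
      = α ^ 2 * (u ⬝ᵥ (G *ᵥ u)) - 2 * α * (u ⬝ᵥ (G *ᵥ v))
        + (u ⬝ᵥ (G *ᵥ v)) ^ 2 / (u ⬝ᵥ (G *ᵥ u)) := by
    field_simp
    ring
  linarith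

theorem quadForm_sub_sq_div_eq {G : Mat d} (hG : G.PosDef) {u : Fin d → ℝ} (hu : u ≠ 0)
    (v : Fin d → ℝ) :
    v ⬝ᵥ (G *ᵥ v) - (u ⬝ᵥ (G *ᵥ v)) ^ 2 / (u ⬝ᵥ (G *ᵥ u))
      = (v - ((u ⬝ᵥ (G *ᵥ v)) / (u ⬝ᵥ (G *ᵥ u))) • u) ⬝ᵥ
        (G *ᵥ (v - ((u ⬝ᵥ (G *ᵥ v)) / (u ⬝ᵥ (G *ᵥ u))) • u)) := by
  rw [quadForm_sub_smul hG.1]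
  have hp := PosDef.quadForm_pos hG hu
  field_simp
  ring

theorem le_quadForm_bfgs {A G : Mat d} (hA : A.PosDef) (hG : G.PosDef) {c : ℝ} (hc : 0 ≤ c)
    (hc1 : c ≤ 1) (h : ∀ v, c * (v ⬝ᵥ (A *ᵥ v)) ≤ v ⬝ᵥ (G *ᵥ v)) (u v : Fin d → ℝ) :
    c * (v ⬝ᵥ (A *ᵥ v)) ≤ v ⬝ᵥ (bfgs A G u *ᵥ v) := by
  by_cases hu : u = 0
  · rw [hu, bfgs_zero]; exact h v
  rw [quadForm_bfgs hA.1 hG.1, quadForm_sub_sq_div_eq hG hu]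
  refine le_trans ?_ (add_le_add_left (h _) _)
  have h1 := mul_le_mul_of_nonneg_left
    (quadForm_sub_sq_div_le hA hu v ((u ⬝ᵥ (G *ᵥ v)) / (u ⬝ᵥ (G *ᵥ u)))) hc
  have hp := PosDef.quadForm_pos hA hu
  have h2 : 0 ≤ (u ⬝ᵥ (A *ᵥ v)) ^ 2 / (u ⬝ᵥ (A *ᵥ u)) := by positivity
  nlinarith

theorem quadForm_bfgs_le {A G : Mat d} (hA : A.PosDef) (hG : G.PosDef) {η : ℝ}
    (hη : 1 ≤ η) (h : ∀ v, v ⬝ᵥ (G *ᵥ v) ≤ η * (v ⬝ᵥ (A *ᵥ v))) (u v : Fin d → ℝ) :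
    v ⬝ᵥ (bfgs A G u *ᵥ v) ≤ η * (v ⬝ᵥ (A *ᵥ v)) := by
  by_cases hu : u = 0
  · rw [hu, bfgs_zero]; exact h v
  rw [quadForm_bfgs hA.1 hG.1]
  have h1 := quadForm_sub_sq_div_le hG hu v ((u ⬝ᵥ (A *ᵥ v)) / (u ⬝ᵥ (A *ᵥ u)))
  have h3 := h (v - ((u ⬝ᵥ (A *ᵥ v)) / (u ⬝ᵥ (A *ᵥ u))) • u)
  rw [← quadForm_sub_sq_div_eq hA hu] at h3
  have hp := PosDef.quadForm_pos hA hu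
  have h2 : 0 ≤ (u ⬝ᵥ (A *ᵥ v)) ^ 2 / (u ⬝ᵥ (A *ᵥ u)) := by positivity
  nlinarith

theorem posDef_of_le {A G : Mat d} (hA : A.PosDef) (hG : G.IsHermitian) {c : ℝ} (hc : 0 < c)
    (h : ∀ v, c * (v ⬝ᵥ (A *ᵥ v)) ≤ v ⬝ᵥ (G *ᵥ v)) : G.PosDef :=
  PosDef.of_dotProduct_mulVec_pos hG fun v hv => by
    have := PosDef.quadForm_pos hA hv
    simpa using lt_of_lt_of_le (mul_pos hc this) (h v)

theorem trace_inv_mul_bfgs {A G : Mat d} (hA : A.PosDef) (hG : G.PosDef) {u : Fin d → ℝ}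
    (hu : u ≠ 0) :
    (A⁻¹ * bfgs A G u).trace = (A⁻¹ * G).trace
      - (u ⬝ᵥ (G *ᵥ u))⁻¹ * ((G *ᵥ u) ⬝ᵥ (A⁻¹ *ᵥ (G *ᵥ u))) + 1 := by
  have key : ∀ B : Mat d, B.IsHermitian →
      (A⁻¹ * (B * vecMulVec u u * B)).trace = (B *ᵥ u) ⬝ᵥ (A⁻¹ *ᵥ (B *ᵥ u)) := by
    intro B hB
    have hB' : Bᵀ = B := by
      simpa [Matrix.IsHermitian, conjTranspose_eq_transpose_of_trivial] using hB
    rw [← trace_mul_vecMulVec, mul_vecMulVec, vecMulVec_mul, ← mulVec_transpose, hB']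
  have hp := PosDef.quadForm_pos hA hu
  simp only [bfgs, Matrix.mul_add, Matrix.mul_sub, Matrix.mul_smul, trace_add, trace_sub,
    trace_smul, smul_eq_mul, key A hA.1, key G hG.1]
  rw [mulVec_mulVec u A⁻¹ A, PosDef.inv_mul_cancel hA, one_mulVec, dotProduct_comm (A *ᵥ u) u,
    inv_mul_cancel₀ hp.ne']

end BFGS

/-! ### Hessian and averaged Hessian -/

section Hessian

variable {d : ℕ} {f : Vec d → ℝ} {μ L M : ℝ}

theorem dotProduct_hess_mulVec (f : Vec d → ℝ) (x v w : Vec d) :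
    WithLp.ofLp v ⬝ᵥ (hess f x *ᵥ WithLp.ofLp w) = fderiv ℝ (fderiv ℝ f) x v w := by
  have expand : ∀ u : Vec d, u = ∑ i, u i • EuclideanSpace.single i (1 : ℝ) := fun u => by
    ext j
    simp [Finset.sum_apply, Pi.single_apply]
  conv_rhs => rw [expand v, expand w]
  simp only [map_sum, map_smul, _root_.sum_apply, _root_.smul_apply,
    smul_eq_mul, dotProduct, mulVec, hess, of_apply]
  simp only [Finset.mul_sum]
  rw [Finset.sum_comm]
  refine Finset.sum_congr rfl fun i _ => ?_
  exact Finset.sum_congr rfl fun j _ => by ring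

theorem dotProduct_ofLp_self (v : Vec d) : WithLp.ofLp v ⬝ᵥ WithLp.ofLp v = ‖v‖ ^ 2 := by
  rw [EuclideanSpace.real_norm_sq_eq]
  simp [dotProduct, sq]

theorem grad_apply (f : Vec d → ℝ) (x : Vec d) (i : Fin d) :
    grad f x i = fderiv ℝ f x (EuclideanSpace.single i 1) := by
  rw [← inner_gradient_left, EuclideanSpace.inner_single_right]
  simp [grad]

namespace StronglyConvexSmooth

theorem isHermitian_hess (hf : StronglyConvexSmooth f μ L) (x : Vec d) :
    (hess f x).IsHermitian := by
  ext i j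
  simp only [conjTranspose_apply, hess, of_apply, star_trivial]
  exact second_derivative_symmetric (fun y => (hf.differentiable y).hasFDerivAt)
    (hf.differentiable_fderiv x).hasFDerivAt _ _

theorem quadForm_hess_le (hf : StronglyConvexSmooth f μ L) (hL : 0 ≤ L) (x : Vec d)
    (v : Fin d → ℝ) : v ⬝ᵥ (hess f x *ᵥ v) ≤ L * (v ⬝ᵥ v) := by
  have hlip : ‖fderiv ℝ (fderiv ℝ f) x‖ ≤ L := by
    refine norm_fderiv_le_of_lip' ℝ hL (Filter.Eventually.of_forall fun y => ?_)
    rw [← toDual_gradient, ← toDual_gradient, ← map_sub, LinearIsometryEquiv.norm_map]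
    exact hf.lipschitz y x
  have h := dotProduct_hess_mulVec f x (WithLp.toLp 2 v) (WithLp.toLp 2 v)
  have h2 := dotProduct_ofLp_self (WithLp.toLp 2 v)
  simp only at h h2
  rw [h, h2]
  refine (Real.le_norm_self _).trans ((ContinuousLinearMap.le_opNorm₂ _ _ _).trans ?_)
  rw [sq, ← mul_assoc]
  gcongr

theorem le_quadForm_hess (hf : StronglyConvexSmooth f μ L) (x : Vec d)
    (v : Fin d → ℝ) : μ * (v ⬝ᵥ v) ≤ v ⬝ᵥ (hess f x *ᵥ v) := by
  set w : Vec d := WithLp.toLp 2 v with hw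
  have h := dotProduct_hess_mulVec f x w w
  have h2 := dotProduct_ofLp_self w
  simp only [hw, WithLp.ofLp_toLp] at h h2
  rw [← hw] at h h2
  rw [h, h2]
  -- `t ↦ f (x + t w) - μ / 2 * ‖x + t w‖²` is convex, so its derivative is monotone.
  have hline : ∀ t : ℝ, HasDerivAt (fun t : ℝ => x + t • w) w t := fun t => by
    simpa using ((hasDerivAt_id t).smul_const w).const_add x
  have hconv := (strongConvexOn_iff_convex.1 hf.strongConvexOn).comp_affineMap
    (AffineMap.lineMap x (x + w) : ℝ →ᵃ[ℝ] Vec d)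
  have hd : ∀ t : ℝ, HasDerivAt ((fun x => f x - μ / (2 : ℝ) * ‖x‖ ^ 2) ∘
      (AffineMap.lineMap x (x + w) : ℝ →ᵃ[ℝ] Vec d))
      (fderiv ℝ f (x + t • w) w - μ * inner ℝ (x + t • w) w) t := by
    intro t
    have e : (fun x => f x - μ / (2 : ℝ) * ‖x‖ ^ 2) ∘
      (AffineMap.lineMap x (x + w) : ℝ →ᵃ[ℝ] Vec d)
        = fun t : ℝ => f (x + t • w) - μ / (2 : ℝ) * ‖x + t • w‖ ^ 2 := by
      funext s
      simp [AffineMap.lineMap_apply, add_comm]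
    rw [e]
    have h1 := (hf.differentiable (x + t • w)).hasFDerivAt.comp_hasDerivAt t (hline t)
    have h2 := ((hline t).norm_sq).const_mul (μ / 2)
    refine (h1.sub h2).congr_deriv ?_
    ring
  have hmono := hconv.monotoneOn_deriv fun t _ => (hd t).differentiableAt
  rw [Set.preimage_univ, monotoneOn_univ] at hmono
  have h3 := Monotone.deriv_nonneg hmono (x := (0 : ℝ))
  rw [show deriv ((fun x => f x - μ / (2 : ℝ) * ‖x‖ ^ 2) ∘
      (AffineMap.lineMap x (x + w) : ℝ →ᵃ[ℝ] Vec d))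
      = fun t => fderiv ℝ f (x + t • w) w - μ * inner ℝ (x + t • w) w from
      funext fun t => (hd t).deriv] at h3
  have h4 : HasDerivAt (fun t : ℝ => fderiv ℝ f (x + t • w) w)
      (fderiv ℝ (fderiv ℝ f) x w w) 0 := by
    have hx : x = x + (0 : ℝ) • w := by simp
    have := (hf.differentiable_fderiv (x + (0 : ℝ) • w)).hasFDerivAt.comp_hasDerivAt 0 (hline 0)
    rw [← hx] at this
    simpa using HasDerivAt.clm_apply this (hasDerivAt_const 0 w)
  have h5 : HasDerivAt (fun t : ℝ => μ * inner ℝ (x + t • w) w) (μ * ‖w‖ ^ 2) 0 := by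
    have := ((hline 0).inner ℝ (hasDerivAt_const (0 : ℝ) w)).const_mul μ
    simpa using this
  have h6 := (HasDerivAt.fun_sub h4 h5).deriv
  rw [h6] at h3
  linarith

theorem posDef_hess (hf : StronglyConvexSmooth f μ L) (hμ : 0 < μ) (x : Vec d) :
    (hess f x).PosDef :=
  posDef_of_le PosDef.one (hf.isHermitian_hess x) hμ fun v => by
    simpa using hf.le_quadForm_hess x v

theorem le_of_one_le_dim (hf : StronglyConvexSmooth f μ L) (hL : 0 ≤ L) (hd : 1 ≤ d) :
    μ ≤ L := by
  have := (hf.le_quadForm_hess 0 (Pi.single ⟨0, hd⟩ 1)).trans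
    (hf.quadForm_hess_le hL 0 (Pi.single ⟨0, hd⟩ 1))
  simpa using this

theorem hasDerivAt_grad_line (hf : StronglyConvexSmooth f μ L) (x s : Vec d) (i : Fin d)
    (t : ℝ) : HasDerivAt (fun t : ℝ => grad f (x + t • s) i)
      ((hess f (x + t • s) *ᵥ WithLp.ofLp s) i) t := by
  have hline : HasDerivAt (fun t : ℝ => x + t • s) s t := by
    simpa using ((hasDerivAt_id t).smul_const s).const_add x
  have h1 : HasDerivAt (fun t : ℝ => fderiv ℝ f (x + t • s))
      (fderiv ℝ (fderiv ℝ f) (x + t • s) s) t :=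
    (hf.differentiable_fderiv (x + t • s)).hasFDerivAt.comp_hasDerivAt t hline
  have h := h1.clm_apply (hasDerivAt_const t (EuclideanSpace.single i (1 : ℝ)))
  rw [map_zero, add_zero] at h
  have e : (hess f (x + t • s) *ᵥ WithLp.ofLp s) i
      = fderiv ℝ (fderiv ℝ f) (x + t • s) s (EuclideanSpace.single i (1 : ℝ)) := by
    rw [← dotProduct_hess_mulVec, dotProduct_mulVec_comm_of_isHermitian (hf.isHermitian_hess _)]
    simp
  rw [e]
  simp only [grad_apply]
  exact h

theorem continuous_grad (hf : StronglyConvexSmooth f μ L) : Continuous (grad f) := by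
  refine continuous_pi fun i => ?_
  simp only [grad_apply]
  exact hf.differentiable_fderiv.continuous.clm_apply continuous_const

end StronglyConvexSmooth

theorem localNorm_smul {τ : ℝ} (hτ : 0 ≤ τ) (z v : Vec d) :
    localNorm f z (τ • v) = τ * localNorm f z v := by
  have : WithLp.ofLp (τ • v) ⬝ᵥ (hess f z *ᵥ WithLp.ofLp (τ • v))
      = τ ^ 2 * (WithLp.ofLp v ⬝ᵥ (hess f z *ᵥ WithLp.ofLp v)) := by
    simp only [WithLp.ofLp_smul, mulVec_smul, smul_dotProduct, dotProduct_smul, smul_eq_mul]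
    ring
  rw [localNorm, this, Real.sqrt_mul (sq_nonneg τ), Real.sqrt_sq hτ, localNorm]

theorem StronglySelfConcordant.quadForm_sub_le (hsc : StronglySelfConcordant f M)
    (x y z w : Vec d) (v : Fin d → ℝ) :
    v ⬝ᵥ (hess f y *ᵥ v) - v ⬝ᵥ (hess f x *ᵥ v)
      ≤ M * localNorm f z (y - x) * (v ⬝ᵥ (hess f w *ᵥ v)) := by
  have := (hsc x y z w).dotProduct_mulVec_nonneg v
  simp only [star_trivial, sub_mulVec, smul_mulVec, dotProduct_sub, dotProduct_smul,
    smul_eq_mul] at this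
  linarith

/-- A strongly self-concordant function with bounded Hessian has a Lipschitz Hessian. -/
theorem continuous_hess (hf : StronglyConvexSmooth f μ L) (hL : 0 ≤ L) (hM : 0 ≤ M)
    (hsc : StronglySelfConcordant f M) : Continuous (hess f) := by
  have hq : ∀ v : Fin d → ℝ, Continuous fun x => v ⬝ᵥ (hess f x *ᵥ v) := by
    intro v
    have hv : 0 ≤ v ⬝ᵥ v := by
      simpa using dotProduct_star_self_nonneg v
    have hnorm : ∀ z u : Vec d, localNorm f z u ≤ Real.sqrt L * ‖u‖ := by
      intro z u
      rw [localNorm, ← Real.sqrt_sq (norm_nonneg u), ← Real.sqrt_mul hL, ← dotProduct_ofLp_self]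
      exact Real.sqrt_le_sqrt (hf.quadForm_hess_le hL z _)
    have hone : ∀ x y : Vec d, v ⬝ᵥ (hess f y *ᵥ v) - v ⬝ᵥ (hess f x *ᵥ v)
        ≤ (M * Real.sqrt L * (L * (v ⬝ᵥ v))) * ‖y - x‖ := by
      intro x y
      refine (hsc.quadForm_sub_le x y x x v).trans ?_
      calc M * localNorm f x (y - x) * (v ⬝ᵥ (hess f x *ᵥ v))
          ≤ M * localNorm f x (y - x) * (L * (v ⬝ᵥ v)) := by
            have : 0 ≤ localNorm f x (y - x) := Real.sqrt_nonneg _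
            gcongr
            exact hf.quadForm_hess_le hL x v
        _ ≤ M * (Real.sqrt L * ‖y - x‖) * (L * (v ⬝ᵥ v)) := by
            gcongr
            exact hnorm _ _
        _ = _ := by ring
    have hC : 0 ≤ M * Real.sqrt L * (L * (v ⬝ᵥ v)) := by positivity
    refine (LipschitzWith.of_dist_le_mul (K := ⟨_, hC⟩) fun x y => ?_).continuous
    rw [Real.dist_eq, dist_eq_norm, abs_le]
    have h1 := hone x y
    have h2 := hone y x
    rw [norm_sub_rev] at h1
    exact ⟨neg_le.1 ((neg_sub _ _).trans_le h1), h2⟩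
  refine continuous_matrix fun i j => ?_
  have e : ∀ x, hess f x i j = ((Pi.single i 1 + Pi.single j 1) ⬝ᵥ
      (hess f x *ᵥ (Pi.single i 1 + Pi.single j 1)) - Pi.single i 1 ⬝ᵥ (hess f x *ᵥ Pi.single i 1)
      - Pi.single j 1 ⬝ᵥ (hess f x *ᵥ Pi.single j 1)) / 2 := by
    intro x
    have hs : hess f x j i = hess f x i j := by
      simpa using congrFun (congrFun (hf.isHermitian_hess x) i) j
    simp [mulVec_add, add_dotProduct, dotProduct_add, hs]
    ring
  simp only [e]
  exact (((hq _).sub (hq _)).sub (hq _)).div_const 2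

end Hessian

section AverageHessian

variable {d : ℕ} {f : Vec d → ℝ} {μ L M : ℝ}

theorem quadForm_avgHess (hH : Continuous (hess f)) (x y : Vec d) (v w : Fin d → ℝ) :
    v ⬝ᵥ (avgHess f x y *ᵥ w)
      = ∫ τ in (0 : ℝ)..1, v ⬝ᵥ (hess f (x + τ • (y - x)) *ᵥ w) := by
  have hc : ∀ i j, Continuous fun τ : ℝ => hess f (x + τ • (y - x)) i j := fun i j =>
    (hH.comp (by fun_prop : Continuous fun τ : ℝ => x + τ • (y - x))).matrix_elem i j
  simp only [dotProduct, mulVec, avgHess, of_apply]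
  rw [intervalIntegral.integral_finsetSum fun i _ => ?_]
  · refine Finset.sum_congr rfl fun i _ => ?_
    rw [intervalIntegral.integral_const_mul, intervalIntegral.integral_finsetSum fun j _ => ?_]
    · simp only [intervalIntegral.integral_mul_const]
    · exact ((hc i j).mul_const _).intervalIntegrable _ _
  · exact (continuous_const.mul (continuous_finsetSum _ fun j _ =>
      (hc i j).mul_const _)).intervalIntegrable _ _

theorem isHermitian_avgHess (hf : StronglyConvexSmooth f μ L) (x y : Vec d) :
    (avgHess f x y).IsHermitian := by
  ext i j
  simp only [conjTranspose_apply, avgHess, of_apply, star_trivial]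
  refine intervalIntegral.integral_congr fun τ _ => ?_
  simpa using congrFun (congrFun (hf.isHermitian_hess (x + τ • (y - x))) i) j

theorem grad_sub_grad (hf : StronglyConvexSmooth f μ L) (hH : Continuous (hess f)) (x y : Vec d) :
    grad f y - grad f x = avgHess f x y *ᵥ WithLp.ofLp (y - x) := by
  ext i
  have h := quadForm_avgHess hH x y (Pi.single i 1) (WithLp.ofLp (y - x))
  simp only [single_dotProduct, one_mul] at h
  rw [h, intervalIntegral.integral_eq_sub_of_hasDerivAt
    (f := fun τ : ℝ => grad f (x + τ • (y - x)) i)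
    (fun τ _ => hf.hasDerivAt_grad_line x (y - x) i τ)]
  · simp
  · refine Continuous.intervalIntegrable ?_ _ _
    have hc := hH.comp (by fun_prop : Continuous fun τ : ℝ => x + τ • (y - x))
    exact (continuous_apply i).comp (hc.matrix_mulVec continuous_const)

/-- The averaged Hessian on `[x, y]` and the Hessians at both ends agree up to the factor
`1 + M r / 2`, where `r = ‖y - x‖_x`. -/
theorem avgHess_bounds (hsc : StronglySelfConcordant f M)
    (hH : Continuous (hess f)) (x y : Vec d) (v : Fin d → ℝ) :
    v ⬝ᵥ (avgHess f x y *ᵥ v)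
        ≤ (1 + M * localNorm f x (y - x) / 2) * (v ⬝ᵥ (hess f x *ᵥ v)) ∧
    v ⬝ᵥ (hess f x *ᵥ v)
        ≤ (1 + M * localNorm f x (y - x) / 2) * (v ⬝ᵥ (avgHess f x y *ᵥ v)) ∧
    v ⬝ᵥ (avgHess f x y *ᵥ v)
        ≤ (1 + M * localNorm f x (y - x) / 2) * (v ⬝ᵥ (hess f y *ᵥ v)) ∧
    v ⬝ᵥ (hess f y *ᵥ v)
        ≤ (1 + M * localNorm f x (y - x) / 2) * (v ⬝ᵥ (avgHess f x y *ᵥ v)) := by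
  set r := localNorm f x (y - x) with hr
  set φ : ℝ → ℝ := fun τ => v ⬝ᵥ (hess f (x + τ • (y - x)) *ᵥ v) with hφ
  have hφc : Continuous φ :=
    continuous_const.dotProduct ((hH.comp (by fun_prop :
      Continuous fun τ : ℝ => x + τ • (y - x))).matrix_mulVec continuous_const)
  have hJ : v ⬝ᵥ (avgHess f x y *ᵥ v) = ∫ τ in (0 : ℝ)..1, φ τ := quadForm_avgHess hH x y v v
  have i1 : ∫ τ in (0 : ℝ)..1, τ = 1 / 2 := by simp
  have i2 : ∫ τ in (0 : ℝ)..1, (1 - τ) = 1 / 2 := by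
    rw [intervalIntegral.integral_sub (by simp) (by simp), i1]; norm_num
  have hint : IntervalIntegrable φ volume 0 1 := hφc.intervalIntegrable _ _
  have dx : ∀ τ : ℝ, x + τ • (y - x) - x = τ • (y - x) := fun τ => by abel
  have dy : ∀ τ : ℝ, y - (x + τ • (y - x)) = (1 - τ) • (y - x) := fun τ => by
    rw [sub_smul, one_smul]; abel
  have nrm : ∀ u : Vec d, localNorm f x (-u) = localNorm f x u := fun u => by
    simp [localNorm, mulVec_neg]
  -- pointwise bounds along the segment, with an arbitrary reference point `w`
  have px : ∀ w, ∀ τ ∈ Set.Icc (0 : ℝ) 1, φ τ - v ⬝ᵥ (hess f x *ᵥ v)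
      ≤ τ * (M * r * (v ⬝ᵥ (hess f w *ᵥ v))) := fun w τ hτ => by
    have := hsc.quadForm_sub_le x (x + τ • (y - x)) x w v
    rw [dx, localNorm_smul hτ.1] at this
    linarith
  have px' : ∀ w, ∀ τ ∈ Set.Icc (0 : ℝ) 1, v ⬝ᵥ (hess f x *ᵥ v) - φ τ
      ≤ τ * (M * r * (v ⬝ᵥ (hess f w *ᵥ v))) := fun w τ hτ => by
    have := hsc.quadForm_sub_le (x + τ • (y - x)) x x w v
    rw [← neg_sub (x + τ • (y - x)) x, dx, nrm, localNorm_smul hτ.1] at this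
    linarith
  have py : ∀ w, ∀ τ ∈ Set.Icc (0 : ℝ) 1, v ⬝ᵥ (hess f y *ᵥ v) - φ τ
      ≤ (1 - τ) * (M * r * (v ⬝ᵥ (hess f w *ᵥ v))) := fun w τ hτ => by
    have := hsc.quadForm_sub_le (x + τ • (y - x)) y x w v
    rw [dy, localNorm_smul (by linarith [hτ.2])] at this
    linarith
  have py' : ∀ w, ∀ τ ∈ Set.Icc (0 : ℝ) 1, φ τ - v ⬝ᵥ (hess f y *ᵥ v)
      ≤ (1 - τ) * (M * r * (v ⬝ᵥ (hess f w *ᵥ v))) := fun w τ hτ => by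
    have := hsc.quadForm_sub_le y (x + τ • (y - x)) x w v
    rw [← neg_sub y, dy, nrm, localNorm_smul (by linarith [hτ.2])] at this
    linarith
  -- integrating a pointwise bound over the segment
  have up : ∀ c (K : ℝ) (g : ℝ → ℝ), Continuous g → ∫ τ in (0 : ℝ)..1, g τ = 1 / 2 →
      (∀ τ ∈ Set.Icc (0 : ℝ) 1, φ τ - c ≤ g τ * K) → (∫ τ in (0 : ℝ)..1, φ τ) - c ≤ K / 2 := by
    intro c K g hg hgi hb
    have := intervalIntegral.integral_mono_on zero_le_one (hint.sub (by simp))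
      ((hg.mul_const K).intervalIntegrable _ _) hb
    rw [intervalIntegral.integral_sub hint (by simp), intervalIntegral.integral_mul_const,
      hgi] at this
    simp at this
    linarith
  have dn : ∀ c (K : ℝ) (g : ℝ → ℝ), Continuous g → ∫ τ in (0 : ℝ)..1, g τ = 1 / 2 →
      (∀ τ ∈ Set.Icc (0 : ℝ) 1, c - φ τ ≤ g τ * K) → c - (∫ τ in (0 : ℝ)..1, φ τ) ≤ K / 2 := by
    intro c K g hg hgi hb
    have := intervalIntegral.integral_mono_on zero_le_one (IntervalIntegrable.sub (by simp) hint)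
      ((hg.mul_const K).intervalIntegrable _ _) hb
    rw [intervalIntegral.integral_sub (by simp) hint, intervalIntegral.integral_mul_const,
      hgi] at this
    simp at this
    linarith
  have c1 : Continuous fun τ : ℝ => τ := continuous_id
  have c2 : Continuous fun τ : ℝ => 1 - τ := continuous_const.sub continuous_id
  -- a bound valid for every reference point holds for their average
  have avg : ∀ c, (∀ w, c ≤ M * r * (v ⬝ᵥ (hess f w *ᵥ v)) / 2) →
      c ≤ M * r / 2 * ∫ τ in (0 : ℝ)..1, φ τ := by
    intro c hb
    have := intervalIntegral.integral_mono_on zero_le_one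
      (intervalIntegrable_const (μ := volume) (c := c))
      ((hφc.const_mul (M * r / 2)).intervalIntegrable 0 1)
      (fun τ _ => (hb (x + τ • (y - x))).trans_eq (by simp only [hφ]; ring) :
        ∀ τ ∈ Set.Icc (0 : ℝ) 1, (fun _ => c) τ ≤ M * r / 2 * φ τ)
    rw [intervalIntegral.integral_const_mul] at this
    simpa using this
  rw [hJ]
  refine ⟨?_, ?_, ?_, ?_⟩
  · linarith [up _ _ _ c1 i1 (px x)]
  · linarith [avg _ fun w => dn _ _ _ c1 i1 (px' w)]
  · linarith [up _ _ _ c2 i2 (py' y)]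
  · linarith [avg _ fun w => dn _ _ _ c2 i2 (py w)]

end AverageHessian

/-! ### One deterministic iteration -/

section OneStep

variable {d : ℕ} {f : Vec d → ℝ} {μ L M : ℝ}

theorem newtonDecrement_nonneg (f : Vec d → ℝ) (x : Vec d) : 0 ≤ newtonDecrement f x :=
  Real.sqrt_nonneg _

theorem newtonDecrement_sq {x : Vec d} (hH : (hess f x).PosDef) :
    newtonDecrement f x ^ 2 = grad f x ⬝ᵥ ((hess f x)⁻¹ *ᵥ grad f x) :=
  Real.sq_sqrt (PosDef.quadForm_nonneg hH.inv _)

/-- The error `M r / 2` made by replacing the averaged Hessian along the quasi-Newton step from `x`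
with matrix `G` by the Hessian at one of the end points; here `r` is the local length of the
step. -/
noncomputable def stepError (f : Vec d → ℝ) (M : ℝ) (x : Vec d) (G : Mat d) : ℝ :=
  M * localNorm f x (qnStep f x G - x) / 2

theorem stepError_nonneg (f : Vec d → ℝ) (hM : 0 ≤ M) (x : Vec d) (G : Mat d) :
    0 ≤ stepError f M x G := by
  have : 0 ≤ localNorm f x (qnStep f x G - x) := Real.sqrt_nonneg _
  unfold stepError
  positivity

theorem corrected_eq (f : Vec d → ℝ) (M : ℝ) (x : Vec d) (G : Mat d) :
    corrected f M x G = (1 + stepError f M x G) ^ 2 •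
      bfgs (avgHess f x (qnStep f x G)) G (WithLp.ofLp (qnStep f x G - x)) := rfl

theorem mulVec_qnStep_sub {G : Mat d} (hG : G.PosDef) (x : Vec d) :
    G *ᵥ WithLp.ofLp (qnStep f x G - x) = -grad f x := by
  have : WithLp.ofLp (qnStep f x G - x) = -(G⁻¹ *ᵥ grad f x) := by
    ext i
    simp [qnStep]
  rw [this, mulVec_neg, PosDef.mulVec_inv_mulVec hG]

theorem posDef_of_hess_le {x : Vec d} {G : Mat d} (hH : (hess f x).PosDef) (hG : G.IsHermitian)
    (hle : ∀ v, v ⬝ᵥ (hess f x *ᵥ v) ≤ v ⬝ᵥ (G *ᵥ v)) : G.PosDef :=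
  posDef_of_le hH hG one_pos fun v => by simpa using hle v

/-- If `G` dominates the Hessian, then the quasi-Newton step is at most as long as the Newton
step. -/
theorem stepError_le {x : Vec d} {G : Mat d} (hM : 0 ≤ M) (hH : (hess f x).PosDef)
    (hG : G.IsHermitian) (hle : ∀ v, v ⬝ᵥ (hess f x *ᵥ v) ≤ v ⬝ᵥ (G *ᵥ v)) :
    stepError f M x G ≤ M * newtonDecrement f x / 2 := by
  have hGp := posDef_of_hess_le hH hG hle
  suffices h : localNorm f x (qnStep f x G - x) ≤ newtonDecrement f x by
    unfold stepError; gcongr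
  refine Real.sqrt_le_sqrt ((hle _).trans ?_)
  have h := quadForm_inv_le hH hGp one_pos (by simpa using hle) (grad f x)
  rw [one_mul] at h
  refine le_trans (le_of_eq ?_) h
  have hs := mulVec_qnStep_sub (f := f) hGp x
  have hg : grad f x = -(G *ᵥ WithLp.ofLp (qnStep f x G - x)) := by rw [hs, neg_neg]
  rw [hg, mulVec_neg, mulVec_mulVec _ G⁻¹ G, PosDef.inv_mul_cancel hGp, one_mulVec, dotProduct_neg,
    neg_dotProduct, neg_neg, dotProduct_comm]

/-- The corrected matrix dominates the Hessian at the next iterate, and exceeds it by a factor that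
grows by at most `(1 + ε)⁴`. -/
theorem corrected_bounds (hf : StronglyConvexSmooth f μ L) (hμ : 0 < μ) (hM : 0 ≤ M)
    (hsc : StronglySelfConcordant f M) (hHc : Continuous (hess f)) {x : Vec d} {G : Mat d}
    (hG : G.IsHermitian) (hle : ∀ v, v ⬝ᵥ (hess f x *ᵥ v) ≤ v ⬝ᵥ (G *ᵥ v)) {η : ℝ} (hη : 1 ≤ η)
    (hge : ∀ v, v ⬝ᵥ (G *ᵥ v) ≤ η * (v ⬝ᵥ (hess f x *ᵥ v))) :
    (avgHess f x (qnStep f x G)).PosDef ∧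
    (bfgs (avgHess f x (qnStep f x G)) G (WithLp.ofLp (qnStep f x G - x))).PosDef ∧
    (corrected f M x G).PosDef ∧
    (∀ v, v ⬝ᵥ (hess f (qnStep f x G) *ᵥ v) ≤ v ⬝ᵥ (corrected f M x G *ᵥ v)) ∧
    (∀ v, v ⬝ᵥ (corrected f M x G *ᵥ v)
      ≤ (η * (1 + stepError f M x G) ^ 4) * (v ⬝ᵥ (hess f (qnStep f x G) *ᵥ v))) := by
  have hHx := hf.posDef_hess hμ x
  have hHy := hf.posDef_hess hμ (qnStep f x G)
  have hGp := posDef_of_hess_le hHx hG hle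
  have hb := avgHess_bounds hsc hHc x (qnStep f x G)
  have hε := stepError_nonneg f hM x G
  have hJh := isHermitian_avgHess hf x (qnStep f x G)
  rw [corrected_eq]
  simp only [show M * localNorm f x (qnStep f x G - x) / 2 = stepError f M x G from rfl] at hb
  set ε := stepError f M x G
  set J := avgHess f x (qnStep f x G)
  set s := WithLp.ofLp (qnStep f x G - x)
  have h1ε : 0 < 1 + ε := by linarith
  have hJ : J.PosDef := posDef_of_le hHx hJh (inv_pos.2 h1ε) fun v => by
    rw [inv_mul_le_iff₀ h1ε]; exact (hb v).2.1
  have hlow := le_quadForm_bfgs hJ hGp (inv_nonneg.2 h1ε.le) (inv_le_one_of_one_le₀ (by linarith))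
    (fun v => by rw [inv_mul_le_iff₀ h1ε]; exact (hb v).1.trans (by gcongr; exact hle v)) s
  have hup := quadForm_bfgs_le hJ hGp (η := η * (1 + ε)) (by nlinarith)
    (fun v => (hge v).trans (by rw [mul_assoc]; gcongr; exact (hb v).2.1)) s
  have hBh : (bfgs J G s).IsHermitian := isHermitian_bfgs hJh hG s
  have hB : (bfgs J G s).PosDef := posDef_of_le hJ hBh (inv_pos.2 h1ε) hlow
  refine ⟨hJ, hB, hB.smul (by positivity), fun v => ?_, fun v => ?_⟩
  · rw [smul_mulVec, dotProduct_smul, smul_eq_mul]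
    have h1 := hlow v
    rw [inv_mul_le_iff₀ h1ε] at h1
    calc _ ≤ (1 + ε) * (v ⬝ᵥ (J *ᵥ v)) := (hb v).2.2.2
      _ ≤ (1 + ε) * ((1 + ε) * (v ⬝ᵥ (bfgs J G s *ᵥ v))) := by gcongr
      _ = _ := by ring
  · rw [smul_mulVec, dotProduct_smul, smul_eq_mul]
    calc _ ≤ (1 + ε) ^ 2 * (η * (1 + ε) * (v ⬝ᵥ (J *ᵥ v))) := by gcongr; exact hup v
      _ ≤ (1 + ε) ^ 2 * (η * (1 + ε) *
            ((1 + ε) * (v ⬝ᵥ (hess f (qnStep f x G) *ᵥ v)))) := by gcongr; exact (hb v).2.2.1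
      _ = _ := by ring

/-- One iteration contracts the squared Newton decrement by a factor `ϑ` (up to `(1 + ε)²`), and the
same `ϑ` is subtracted from the trace potential `tr (H⁻¹ G) - d` by the BFGS update along the
step. The factor `ϑ` is bounded in terms of any `η` with `G ≼ η ∇²f(x)`. -/
theorem exists_contraction (hf : StronglyConvexSmooth f μ L) (hμ : 0 < μ) (hM : 0 ≤ M)
    (hsc : StronglySelfConcordant f M) (hHc : Continuous (hess f)) {x : Vec d} {G : Mat d}
    (hG : G.IsHermitian) (hle : ∀ v, v ⬝ᵥ (hess f x *ᵥ v) ≤ v ⬝ᵥ (G *ᵥ v))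
    (hε1 : stepError f M x G ≤ 1) :
    ∃ ϑ : ℝ, 0 ≤ ϑ ∧
      newtonDecrement f (qnStep f x G) ^ 2
        ≤ (1 + stepError f M x G) ^ 2 * ϑ * newtonDecrement f x ^ 2 ∧
      (∀ η : ℝ, 1 ≤ η → (∀ v, v ⬝ᵥ (G *ᵥ v) ≤ η * (v ⬝ᵥ (hess f x *ᵥ v))) →
        ϑ ≤ 1 - (1 - stepError f M x G) / (η * (1 + stepError f M x G))) ∧
      ((hess f (qnStep f x G))⁻¹ * corrected f M x G).trace
        ≤ (1 + stepError f M x G) ^ 4 * ((hess f x)⁻¹ * G).trace - ϑ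
          + stepError f M x G * (1 + stepError f M x G) ^ 3 := by
  have hHx := hf.posDef_hess hμ x
  have hHy := hf.posDef_hess hμ (qnStep f x G)
  have hGp := posDef_of_hess_le hHx hG hle
  have hGs := mulVec_qnStep_sub (f := f) hGp x
  by_cases hs0 : qnStep f x G - x = 0
  · have hε0 : stepError f M x G = 0 := by simp [stepError, hs0, localNorm]
    have hy : qnStep f x G = x := sub_eq_zero.1 hs0
    have hg : grad f x = 0 := by
      rw [hs0, WithLp.ofLp_zero, mulVec_zero] at hGs
      exact neg_eq_zero.1 hGs.symm
    refine ⟨0, le_rfl, ?_, fun η hη _ => ?_, ?_⟩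
    · simp [hy, newtonDecrement, hg]
    · rw [hε0]
      have : 1 / η ≤ 1 := by rw [div_le_one (by linarith)]; exact hη
      simpa using this
    · rw [corrected_eq, hε0, hs0, WithLp.ofLp_zero, bfgs_zero, hy]
      simp
  have hs : WithLp.ofLp (qnStep f x G - x) ≠ 0 := fun h => hs0 (by
    ext i; simpa using congrFun h i)
  obtain ⟨η₀, hη₀, hge₀⟩ : ∃ η : ℝ, 1 ≤ η ∧
      ∀ v, v ⬝ᵥ (G *ᵥ v) ≤ η * (v ⬝ᵥ (hess f x *ᵥ v)) :=
    ⟨_, le_add_of_nonneg_right (sub_nonneg.2 (card_le_trace_inv_mul hHx hG hle)),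
      quadForm_le_trace_mul hHx hG hle⟩
  obtain ⟨hJ, hB, -, -, -⟩ := corrected_bounds hf hμ hM hsc hHc hG hle hη₀ hge₀
  have hb := avgHess_bounds hsc hHc x (qnStep f x G)
  have hε := stepError_nonneg f hM x G
  have hgy := grad_sub_grad hf hHc x (qnStep f x G)
  rw [corrected_eq]
  rw [newtonDecrement_sq hHx, newtonDecrement_sq hHy]
  simp only [show M * localNorm f x (qnStep f x G - x) / 2 = stepError f M x G from rfl] at hb
  set ε := stepError f M x G
  set J := avgHess f x (qnStep f x G)
  set s := WithLp.ofLp (qnStep f x G - x)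
  have h1ε : 0 < 1 + ε := by linarith
  set P := (G *ᵥ s) ⬝ᵥ (J⁻¹ *ᵥ (G *ᵥ s)) with hP
  set Q := s ⬝ᵥ (G *ᵥ s) with hQ
  set T := s ⬝ᵥ (J *ᵥ s) with hT
  have hGs0 : G *ᵥ s ≠ 0 := fun h => by
    have := PosDef.quadForm_pos hGp hs
    rw [h, dotProduct_zero] at this
    exact lt_irrefl _ this
  have hPpos : 0 < P := PosDef.quadForm_pos hJ.inv hGs0
  have hQpos : 0 < Q := PosDef.quadForm_pos hGp hs
  have hTQ : T ≤ (1 + ε) * Q := (hb s).1.trans (by gcongr; exact hle s)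
  have hCS : Q ^ 2 ≤ P * T := by
    have := cauchy_schwarz_posDef hJ (G *ᵥ s) s
    rwa [dotProduct_comm (G *ᵥ s) s] at this
  have hPle : P ≤ (1 + ε) * (grad f x ⬝ᵥ ((hess f x)⁻¹ *ᵥ grad f x)) := by
    have := quadForm_inv_le hHx hJ h1ε (fun v => (hb v).2.1) (grad f x)
    rw [hP, hGs]
    simpa [mulVec_neg] using this
  have hres : grad f (qnStep f x G) ⬝ᵥ (J⁻¹ *ᵥ grad f (qnStep f x G)) = P - 2 * Q + T := by
    have e : grad f (qnStep f x G) = J *ᵥ s - G *ᵥ s := by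
      rw [← hgy, hGs]; abel
    rw [e, mulVec_sub, mulVec_mulVec s J⁻¹ J, PosDef.inv_mul_cancel hJ, one_mulVec, sub_dotProduct,
      dotProduct_sub, dotProduct_sub, dotProduct_mulVec_comm_of_isHermitian hJ.inv.1 (J *ᵥ s),
      mulVec_mulVec s J⁻¹ J, PosDef.inv_mul_cancel hJ, one_mulVec, ← hP,
      dotProduct_comm _ s, dotProduct_comm _ s, ← hQ, ← hT]
    ring
  have hN : 0 ≤ P - 2 * Q + T := by
    rw [← hres]; exact PosDef.quadForm_nonneg hJ.inv _
  -- Cauchy-Schwarz: `P / Q ≥ Q / T ≥ 1 / (1 + ε)`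
  have hQP : Q ≤ (1 + ε) * P := by
    have : Q * Q ≤ Q * ((1 + ε) * P) := by nlinarith
    exact le_of_mul_le_mul_left this hQpos
  refine ⟨(P - 2 * Q + T) / P, by positivity, ?_, fun η hη hge => ?_, ?_⟩
  · have h1 := quadForm_inv_le hJ hHy h1ε (fun v => (hb v).2.2.1) (grad f (qnStep f x G))
    rw [hres] at h1
    refine h1.trans ?_
    calc (1 + ε) * (P - 2 * Q + T) = (1 + ε) * ((P - 2 * Q + T) / P) * P := by
          field_simp
      _ ≤ (1 + ε) * ((P - 2 * Q + T) / P) *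
          ((1 + ε) * (grad f x ⬝ᵥ ((hess f x)⁻¹ *ᵥ grad f x))) := by gcongr
      _ = _ := by ring
  · have hPQ : P ≤ η * (1 + ε) * Q := by
      have := quadForm_inv_le hGp hJ (c := η * (1 + ε)) (by positivity)
        (fun v => (hge v).trans (by rw [mul_assoc]; gcongr; exact (hb v).2.1)) (G *ᵥ s)
      rwa [mulVec_mulVec s G⁻¹ G, PosDef.inv_mul_cancel hGp, one_mulVec,
        dotProduct_comm _ s] at this
    rw [div_le_iff₀ hPpos, sub_mul, div_mul_eq_mul_div, one_mul]
    have : (1 - ε) * P / (η * (1 + ε)) ≤ (1 - ε) * Q := by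
      rw [div_le_iff₀ (by positivity)]
      nlinarith
    linarith
  · have t1 := trace_inv_mul_le hJ hHy hB.posSemidef h1ε (fun v => (hb v).2.2.1)
    have t2 := trace_inv_mul_bfgs hJ hGp hs
    have t3 := trace_inv_mul_le hHx hJ hGp.posSemidef h1ε (fun v => (hb v).2.1)
    rw [t2, ← hP, ← hQ] at t1
    rw [Matrix.mul_smul, trace_smul, smul_eq_mul]
    have hϑ : (P - 2 * Q + T) / P ≤ (1 + ε) * (Q⁻¹ * P - 1 + ε) := by
      rw [div_le_iff₀ hPpos]
      have h2 : P - 2 * Q + T ≤ (Q⁻¹ * P - 1 + ε) * Q := by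
        have : (Q⁻¹ * P - 1 + ε) * Q = P - Q + ε * Q := by field_simp
        linarith
      have h3 : 0 ≤ Q⁻¹ * P - 1 + ε := by
        by_contra hneg
        have := mul_neg_of_neg_of_pos (not_le.1 hneg) hQpos
        linarith
      nlinarith [mul_le_mul_of_nonneg_left hQP h3]
    have hϑ0 : 0 ≤ (P - 2 * Q + T) / P := by positivity
    set τ := ((hess f x)⁻¹ * G).trace
    calc _ ≤ (1 + ε) ^ 2 * ((1 + ε) * ((J⁻¹ * G).trace - Q⁻¹ * P + 1)) := by gcongr
      _ ≤ (1 + ε) ^ 2 * ((1 + ε) * ((1 + ε) * τ - Q⁻¹ * P + 1)) := by gcongr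
      _ = (1 + ε) ^ 4 * τ - (1 + ε) ^ 2 * ((1 + ε) * (Q⁻¹ * P - 1 + ε)) + ε * (1 + ε) ^ 3 := by ring
      _ ≤ (1 + ε) ^ 4 * τ - (1 + ε) ^ 2 * ((P - 2 * Q + T) / P) + ε * (1 + ε) ^ 3 := by gcongr
      _ ≤ (1 + ε) ^ 4 * τ - 1 * ((P - 2 * Q + T) / P) + ε * (1 + ε) ^ 3 := by
          gcongr
          exact one_le_pow₀ (by linarith)
      _ = _ := by ring

end OneStep

/-! ### Scalar estimates -/

section Scalars

/-- The factor `1 - 7 / (20 κ)` by which the Newton decrement decreases in every iteration, where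
`κ = L / μ`. -/
noncomputable def linRate (κ : ℝ) : ℝ := 1 - 7 / (20 * κ)

/-- A deterministic bound `(M λ₀ / 2) β^t` for the error `M r_t / 2` of iteration `t`, where `β` is
the linear rate and `c = M λ₀`. -/
noncomputable def errBound (c κ : ℝ) (t : ℕ) : ℝ := c / 2 * linRate κ ^ t

/-- The accumulated factor by which the Hessian approximations deteriorate in the first `t`
iterations. -/
noncomputable def inflation (c κ : ℝ) (t : ℕ) : ℝ :=
  ∏ i ∈ Finset.range t, (1 + errBound c κ i) ^ 4

variable {c κ : ℝ}

theorem linRate_nonneg (hκ : 1 ≤ κ) : 0 ≤ linRate κ := by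
  rw [linRate, sub_nonneg, div_le_one (by linarith)]
  linarith

theorem linRate_le_one (hκ : 1 ≤ κ) : linRate κ ≤ 1 := by
  have : 0 ≤ 7 / (20 * κ) := by positivity
  rw [linRate]; linarith

theorem errBound_nonneg (hκ : 1 ≤ κ) (hc : 0 ≤ c) (t : ℕ) : 0 ≤ errBound c κ t := by
  have := linRate_nonneg hκ
  unfold errBound; positivity

theorem errBound_le (hκ : 1 ≤ κ) (hc : 0 ≤ c) (t : ℕ) : errBound c κ t ≤ c / 2 := by
  have := pow_le_one₀ (linRate_nonneg hκ) (linRate_le_one hκ) (n := t)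
  unfold errBound
  exact mul_le_of_le_one_right (by positivity) this

theorem inflation_succ (c κ : ℝ) (t : ℕ) :
    inflation c κ (t + 1) = inflation c κ t * (1 + errBound c κ t) ^ 4 :=
  Finset.prod_range_succ _ _

theorem one_le_inflation (hκ : 1 ≤ κ) (hc : 0 ≤ c) (t : ℕ) : 1 ≤ inflation c κ t := by
  induction t with
  | zero => simp [inflation]
  | succ t ih =>
    rw [inflation_succ]
    exact one_le_mul_of_one_le_of_one_le ih (one_le_pow₀ (by linarith [errBound_nonneg hκ hc t]))

/-- The errors are summable because the decrement converges linearly; the smallness of `λ₀` makes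
the total inflation at most `5 / 4`. -/
theorem inflation_le (hκ : 1 ≤ κ) (hc : 0 ≤ c) (hs : c * κ ≤ 0.03466) (t : ℕ) :
    inflation c κ t ≤ 5 / 4 := by
  have hβ := linRate_nonneg hκ
  have hgeom : ∑ i ∈ Finset.range t, linRate κ ^ i ≤ 20 * κ / 7 := by
    have h1 := mul_neg_geom_sum (linRate κ) t
    have h2 : 1 - linRate κ = 7 / (20 * κ) := by rw [linRate]; ring
    have h3 := pow_nonneg hβ t
    rw [h2, div_mul_eq_mul_div, div_eq_iff (by positivity)] at h1
    nlinarith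
  calc inflation c κ t ≤ ∏ i ∈ Finset.range t, Real.exp (4 * errBound c κ i) := by
        refine Finset.prod_le_prod (fun i _ => ?_) fun i _ => ?_
        · have := errBound_nonneg hκ hc i; positivity
        · have := errBound_nonneg hκ hc i
          rw [show 4 * errBound c κ i = ((4 : ℕ) : ℝ) * errBound c κ i by norm_num,
            Real.exp_nat_mul]
          gcongr
          linarith [Real.add_one_le_exp (errBound c κ i)]
    _ = Real.exp (2 * c * ∑ i ∈ Finset.range t, linRate κ ^ i) := by
        rw [← Real.exp_sum, Finset.mul_sum]
        congr 1
        refine Finset.sum_congr rfl fun i _ => ?_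
        rw [errBound]; ring
    _ ≤ Real.exp (1 / 5) := by
        gcongr
        have : 2 * c * ∑ i ∈ Finset.range t, linRate κ ^ i ≤ 2 * c * (20 * κ / 7) := by gcongr
        norm_num at hs
        linarith
    _ ≤ 5 / 4 := by
        have h1 := Real.add_one_le_exp (-(1 / 5) : ℝ)
        rw [Real.exp_neg] at h1
        have h2 := Real.exp_pos (1 / 5 : ℝ)
        have h3 : (4 / 5 : ℝ) * Real.exp (1 / 5) ≤ 1 := by
          calc (4 / 5 : ℝ) * Real.exp (1 / 5)
              ≤ (Real.exp (1 / 5))⁻¹ * Real.exp (1 / 5) := by gcongr; linarith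
            _ = 1 := inv_mul_cancel₀ h2.ne'
        linarith

theorem prod_one_add_errBound_le (hκ : 1 ≤ κ) (hc : 0 ≤ c) (hs : c * κ ≤ 0.03466) (t : ℕ) :
    ∏ i ∈ Finset.range t, (1 + errBound c κ i) ≤ 2 := by
  refine le_trans (Finset.prod_le_prod (fun i _ => ?_) fun i _ => ?_)
    ((inflation_le hκ hc hs t).trans (by norm_num))
  · linarith [errBound_nonneg hκ hc i]
  · exact le_self_pow₀ (by linarith [errBound_nonneg hκ hc i]) (by norm_num)

theorem contraction_le_linRate_sq (hκ : 1 ≤ κ) {ε η : ℝ} (hε : 0 ≤ ε) (hεκ : ε * κ ≤ 0.01733)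
    (hη : 1 ≤ η) (hηκ : η ≤ 5 / 4 * κ) :
    (1 + ε) ^ 2 * (1 - (1 - ε) / (η * (1 + ε))) ≤ linRate κ ^ 2 := by
  have hκ0 : 0 < κ := by linarith
  have hη0 : 0 < η := by linarith
  set k := κ⁻¹ with hk
  have hk0 : 0 < k := inv_pos.2 hκ0
  have hk1 : k ≤ 1 := inv_le_one_of_one_le₀ hκ
  have hεk : ε ≤ 0.01733 * k := by
    rw [hk, ← div_eq_mul_inv, le_div_iff₀ hκ0]; exact hεκ
  have hηk : 4 / 5 * k ≤ η⁻¹ := by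
    have := inv_anti₀ hη0 hηκ
    rw [mul_inv] at this
    norm_num at this ⊢
    exact this
  have e : (1 + ε) ^ 2 * (1 - (1 - ε) / (η * (1 + ε)))
      = (1 + ε) ^ 2 - (1 - ε ^ 2) * η⁻¹ := by
    field_simp
    ring
  have e2 : linRate κ = 1 - 7 / 20 * k := by
    rw [linRate, hk]; field_simp
  rw [e, e2]
  have hε1 : ε ≤ 0.01733 := hεk.trans (by nlinarith)
  have h1 : 0.999 ≤ 1 - ε ^ 2 := by nlinarith
  have h2 : 0.999 * (4 / 5 * k) ≤ (1 - ε ^ 2) * η⁻¹ := by gcongr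
  nlinarith

/-- The scalar inequality behind the decrease of the expected potential `σ + 4 m`, where `m` stands
for `d M λ`. The additive error `2.6 m` and the new term `4 m'` are absorbed by the part
`4 m` of the potential together with a small share of `θ²`, because `m` is at most
`0.03466 / κ`. For `d = 1` the factor `1 - 1 / d` vanishes and `θ² ≤ σ + m` is used instead. -/
theorem drift_inequality {d : ℕ} (hd : 1 ≤ d) (hκ : 1 ≤ κ) {m m' e θ σ B : ℝ} (hm : 0 ≤ m)
    (hmκ : m * κ ≤ 0.03466) (he : 0 ≤ e) (he1 : e ≤ 0.01733) (hθ : 0 ≤ θ)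
    (hm' : m' ≤ (1 + e) * θ * m) (hσ : 0 ≤ σ) (hB : 0 ≤ B)
    (hBle : B ≤ (1 + e) ^ 4 * σ - θ ^ 2 + 2.6 * m) (hθσ : θ ^ 2 ≤ σ + m) :
    (1 - 1 / (d : ℝ)) * B + 4 * m'
        + (1 - 1 / (2 * (d : ℝ))) ^ 2 * (1 - 4 / (5 * κ)) * θ ^ 2
      ≤ (1 - 1 / (2 * (d : ℝ))) ^ 2 * (1 + e) ^ 4 * (σ + 4 * m) := by
  have hκ0 : 0 < κ := by linarith
  have hek : 1 ≤ (1 + e) ^ 4 := one_le_pow₀ (by linarith)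
  set k := κ⁻¹ with hk
  have hk0 : 0 < k := inv_pos.2 hκ0
  have hmk : m ≤ 0.03466 * k := by
    rw [hk, ← div_eq_mul_inv, le_div_iff₀ hκ0]; exact hmκ
  have ek : 4 / (5 * κ) = 4 / 5 * k := by rw [hk]; field_simp
  rw [ek]
  have hmm : m' ≤ 1.01733 * (θ * m) := hm'.trans (by
    rw [mul_assoc]
    gcongr
    linarith)
  have hkθ : m * θ ^ 2 ≤ 0.03466 * (k * θ ^ 2) := by nlinarith [sq_nonneg θ]
  rcases hd.eq_or_lt with h1 | h2
  · subst h1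
    norm_num
    -- `k = 1 / κ`: `4 · 1.01733 θ m ≤ k θ² / 5 + 3 m / 4`, as `m ≤ 0.03466 k`
    have hsq : 0 ≤ m * (θ - 0.3611) ^ 2 := by positivity
    have key : 4 * m' ≤ 1 / 5 * (k * θ ^ 2) + 3 / 4 * m := by nlinarith
    have : σ + 4 * m ≤ (1 + e) ^ 4 * (σ + 4 * m) := le_mul_of_one_le_left (by positivity) hek
    nlinarith
  · have hd2 : (2 : ℝ) ≤ d := by exact_mod_cast h2
    have hd0 : (0 : ℝ) < d := by linarith
    set q := (1 - 1 / (2 * (d : ℝ))) ^ 2 with hq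
    have hinv : 1 / (2 * (d : ℝ)) ≤ 1 / 4 := by
      apply one_div_le_one_div_of_le <;> linarith
    have hq1 : 9 / 16 ≤ q := by rw [hq]; nlinarith
    have hpq : 1 - 1 / (d : ℝ) ≤ q := by
      have : q = 1 - 1 / (d : ℝ) + (1 / (2 * (d : ℝ))) ^ 2 := by rw [hq]; field_simp; ring
      nlinarith [sq_nonneg (1 / (2 * (d : ℝ)))]
    have hpB : (1 - 1 / (d : ℝ)) * B ≤ q * ((1 + e) ^ 4 * σ - θ ^ 2 + 2.6 * m) :=
      (mul_le_mul_of_nonneg_right hpq hB).trans (by gcongr)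
    -- the same estimate with `q ≥ 9 / 16`: `4 · 1.01733 θ m ≤ (9 / 16) (4 k θ² / 5 + 1.4 m)`
    have hsq : 0 ≤ m * (θ - 0.2) ^ 2 := by positivity
    have key : 4 * m' ≤ 9 / 16 * (4 / 5 * (k * θ ^ 2) + 1.4 * m) := by nlinarith
    have key2 : 4 * m' ≤ q * (4 / 5 * (k * θ ^ 2) + 1.4 * m) := key.trans (by gcongr)
    have h3 : q * (4 * m) ≤ q * ((1 + e) ^ 4 * (4 * m)) := by
      refine mul_le_mul_of_nonneg_left ?_ (by positivity)
      exact le_mul_of_one_le_left (by positivity) hek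
    linarith [h3, key2, hpB]

theorem trace_error_le {d : ℕ} (hd : 1 ≤ d) {ε : ℝ} (hε : 0 ≤ ε) (hε1 : ε ≤ 0.01733) :
    (d : ℝ) * ((1 + ε) ^ 4 - 1) + ε * (1 + ε) ^ 3 ≤ 5.2 * (d * ε) := by
  have hd1 : (1 : ℝ) ≤ d := by exact_mod_cast hd
  have h1 : (1 + ε) ^ 4 - 1 ≤ 4.12 * ε := by
    have : (1 + ε) ^ 4 - 1 = ε * (4 + 6 * ε + 4 * ε ^ 2 + ε ^ 3) := by ring
    rw [this, mul_comm]
    gcongr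
    nlinarith [pow_le_pow_left₀ hε hε1 2, pow_le_pow_left₀ hε hε1 3]
  have h2 : (1 + ε) ^ 3 ≤ 1.06 := by
    nlinarith [pow_le_pow_left₀ hε hε1 2, pow_le_pow_left₀ hε hε1 3]
  have h3 : ε * (1 + ε) ^ 3 ≤ d * (1.06 * ε) := by
    have : ε * (1 + ε) ^ 3 ≤ 1.06 * ε := by nlinarith
    nlinarith
  have h4 : (d : ℝ) * ((1 + ε) ^ 4 - 1) ≤ d * (4.12 * ε) := by gcongr
  nlinarith

end Scalars

/-! ### Deterministic analysis of a sample path -/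

section Trajectory

variable {d : ℕ} {f : Vec d → ℝ} {μ L M : ℝ}

/-- The standing assumptions on the objective function and on the starting point; the condition on
`λ₀` is the one of the theorem with `ln 2 / 20` replaced by a slightly larger number. -/
structure Assumptions (f : Vec d → ℝ) (μ L M : ℝ) (x₀ : Vec d) : Prop where
  one_le_dim : 1 ≤ d
  mu_pos : 0 < μ
  L_pos : 0 < L
  M_pos : 0 < M
  smooth : StronglyConvexSmooth f μ L
  concordant : StronglySelfConcordant f M
  small : d * (M * newtonDecrement f x₀) * (L / μ) ≤ 0.03466

/-- A sample path of the method with the random directions replaced by arbitrary ones. -/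
structure IsPath (f : Vec d → ℝ) (L M : ℝ) (x : ℕ → Vec d) (G : ℕ → Mat d) : Prop where
  G_zero : G 0 = L • (1 : Mat d)
  x_succ : ∀ t, x (t + 1) = qnStep f (x t) (G t)
  G_succ : ∀ t, ∃ v, G (t + 1) = bfgs (hess f (x (t + 1))) (corrected f M (x t) (G t)) v

/-- The trace potential `tr (∇²f(x)⁻¹ G) - d`. -/
noncomputable def tracePotential (f : Vec d → ℝ) (x : Vec d) (G : Mat d) : ℝ :=
  ((hess f x)⁻¹ * G).trace - d

/-- The contraction factor `λ_{t+1} / ((1 + e_t) λ_t)`; it is zero when `λ_t = 0`. -/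
noncomputable def contraction (f : Vec d → ℝ) (c κ : ℝ) (t : ℕ) (x y : Vec d) : ℝ :=
  newtonDecrement f y / ((1 + errBound c κ t) * newtonDecrement f x)

variable {x₀ : Vec d}

namespace Assumptions

theorem one_le_cond (h : Assumptions f μ L M x₀) : 1 ≤ L / μ :=
  (one_le_div h.mu_pos).2 (h.smooth.le_of_one_le_dim h.L_pos.le h.one_le_dim)

theorem continuous_hess (h : Assumptions f μ L M x₀) : Continuous (hess f) :=
  SharpenedBFGS.continuous_hess h.smooth h.L_pos.le h.M_pos.le h.concordant

theorem posDef_hess (h : Assumptions f μ L M x₀) (x : Vec d) : (hess f x).PosDef :=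
  h.smooth.posDef_hess h.mu_pos x

theorem mul_decrement_nonneg (h : Assumptions f μ L M x₀) : 0 ≤ M * newtonDecrement f x₀ :=
  mul_nonneg h.M_pos.le (newtonDecrement_nonneg _ _)

theorem one_le_dim_real (h : Assumptions f μ L M x₀) : (1 : ℝ) ≤ d := by
  exact_mod_cast h.one_le_dim

theorem mul_decrement_cond_le (h : Assumptions f μ L M x₀) :
    M * newtonDecrement f x₀ * (L / μ) ≤ 0.03466 := by
  have h1 := h.one_le_dim_real
  have h2 : 0 ≤ M * newtonDecrement f x₀ * (L / μ) :=
    mul_nonneg h.mul_decrement_nonneg (by linarith [h.one_le_cond])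
  have h3 := h.small
  rw [mul_assoc] at h3
  nlinarith

theorem errBound_le (h : Assumptions f μ L M x₀) (t : ℕ) :
    errBound (M * newtonDecrement f x₀) (L / μ) t ≤ 0.01733 := by
  have h1 := SharpenedBFGS.errBound_le h.one_le_cond h.mul_decrement_nonneg t
  have h2 := h.mul_decrement_cond_le
  have h3 := h.one_le_cond
  have h4 := h.mul_decrement_nonneg
  norm_num at *
  nlinarith

end Assumptions

/-- Along every sample path the Hessian approximation dominates the Hessian, exceeds it by a factor
of at most `κ` times the inflation, and the Newton decrement decreases linearly. -/
theorem IsPath.invariant (h : Assumptions f μ L M x₀) {x : ℕ → Vec d} {G : ℕ → Mat d}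
    (hp : IsPath f L M x G) (hx : x 0 = x₀) (t : ℕ) :
    (G t).IsHermitian ∧ (∀ v, v ⬝ᵥ (hess f (x t) *ᵥ v) ≤ v ⬝ᵥ (G t *ᵥ v)) ∧
    (∀ v, v ⬝ᵥ (G t *ᵥ v) ≤ (L / μ * inflation (M * newtonDecrement f x₀) (L / μ) t) *
      (v ⬝ᵥ (hess f (x t) *ᵥ v))) ∧
    newtonDecrement f (x t) ≤ linRate (L / μ) ^ t * newtonDecrement f x₀ := by
  have hκ := h.one_le_cond
  have hc := h.mul_decrement_nonneg
  have hμ := h.mu_pos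
  have hsmall := h.mul_decrement_cond_le
  set κ := L / μ with hκdef
  induction t with
  | zero =>
    rw [hp.G_zero, hx]
    refine ⟨?_, fun v => ?_, fun v => ?_, by simp⟩
    · exact (PosDef.one.smul h.L_pos).1
    · simpa [smul_mulVec, dotProduct_smul] using h.smooth.quadForm_hess_le h.L_pos.le x₀ v
    · have := h.smooth.le_quadForm_hess x₀ v
      simp only [inflation, Finset.range_zero, Finset.prod_empty, mul_one, smul_mulVec,
        one_mulVec, dotProduct_smul, smul_eq_mul]
      calc L * (v ⬝ᵥ v) = κ * (μ * (v ⬝ᵥ v)) := by rw [hκdef]; field_simp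
        _ ≤ _ := by gcongr
  | succ t ih =>
    obtain ⟨hG, hle, hge, hlam⟩ := ih
    have hinf := one_le_inflation hκ hc t
    set A := inflation (M * newtonDecrement f x₀) κ t with hA
    have hη : 1 ≤ κ * A := one_le_mul_of_one_le_of_one_le hκ hinf
    have hε0 := stepError_nonneg f h.M_pos.le (x t) (G t)
    have hεe : stepError f M (x t) (G t) ≤ errBound (M * newtonDecrement f x₀) κ t := by
      refine (stepError_le h.M_pos.le (h.posDef_hess _) hG hle).trans ?_
      have := mul_le_mul_of_nonneg_left hlam h.M_pos.le
      rw [errBound]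
      linarith
    have hε1 := hεe.trans (h.errBound_le t)
    obtain ⟨-, -, hĜ, hlow, hup⟩ := corrected_bounds h.smooth hμ h.M_pos.le h.concordant
      h.continuous_hess hG hle hη hge
    obtain ⟨ϑ, hϑ0, hdec, hϑ, -⟩ := exists_contraction h.smooth hμ h.M_pos.le h.concordant
      h.continuous_hess hG hle (by norm_num at hε1; linarith)
    obtain ⟨v₀, hv₀⟩ := hp.G_succ t
    rw [← hp.x_succ] at hlow hup hdec
    rw [hv₀]
    have hη2 : κ * A * (1 + stepError f M (x t) (G t)) ^ 4
        ≤ κ * inflation (M * newtonDecrement f x₀) κ (t + 1) := by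
      rw [inflation_succ, mul_assoc]
      gcongr
    refine ⟨isHermitian_bfgs (h.smooth.isHermitian_hess _) hĜ.1 _, fun v => ?_, fun v => ?_, ?_⟩
    · simpa using le_quadForm_bfgs (h.posDef_hess _) hĜ zero_le_one le_rfl
        (by simpa using hlow) v₀ v
    · refine (quadForm_bfgs_le (h.posDef_hess _) hĜ ?_ hup v₀ v).trans ?_
      · exact one_le_mul_of_one_le_of_one_le hη (one_le_pow₀ (by linarith))
      · gcongr
        exact PosDef.quadForm_nonneg (h.posDef_hess _) v
    · have hεκ : stepError f M (x t) (G t) * κ ≤ 0.01733 := by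
        have h1 := SharpenedBFGS.errBound_le hκ hc t
        have h2 := mul_le_mul_of_nonneg_right (hεe.trans h1) (by linarith : 0 ≤ κ)
        norm_num at hsmall ⊢
        linarith
      have hA54 : κ * A ≤ 5 / 4 * κ := by
        rw [mul_comm]
        gcongr
        exact inflation_le hκ hc hsmall t
      have hcontr := contraction_le_linRate_sq hκ hε0 hεκ hη hA54
      have hϑA := hϑ _ hη hge
      have hβ := linRate_nonneg hκ
      have h1 : newtonDecrement f (x (t + 1)) ^ 2
          ≤ (linRate κ * newtonDecrement f (x t)) ^ 2 := by
        rw [mul_pow]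
        refine hdec.trans (mul_le_mul_of_nonneg_right (le_trans ?_ hcontr) (sq_nonneg _))
        gcongr
      have h2 := (pow_le_pow_iff_left₀ (newtonDecrement_nonneg f _)
        (mul_nonneg hβ (newtonDecrement_nonneg f _)) two_ne_zero).1 h1
      calc _ ≤ _ := h2
        _ ≤ linRate κ * (linRate κ ^ t * newtonDecrement f x₀) := by gcongr
        _ = _ := by ring

theorem contraction_nonneg (h : Assumptions f μ L M x₀) (t : ℕ) (x y : Vec d) :
    0 ≤ contraction f (M * newtonDecrement f x₀) (L / μ) t x y := by
  have := errBound_nonneg h.one_le_cond h.mul_decrement_nonneg t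
  have h1 := newtonDecrement_nonneg f x
  have h2 := newtonDecrement_nonneg f y
  unfold contraction
  positivity

/-- Everything about iteration `t` that the probabilistic argument uses: the decrement contracts by
the factor `θ`, and before the random direction is drawn the trace potential obeys the drift
inequality. -/
theorem IsPath.step (h : Assumptions f μ L M x₀) {x : ℕ → Vec d} {G : ℕ → Mat d}
    (hp : IsPath f L M x G) (hx : x 0 = x₀) (t : ℕ) :
    (corrected f M (x t) (G t)).PosDef ∧
    0 ≤ tracePotential f (x t) (G t) ∧
    tracePotential f (x t) (G t) ≤ 5 / 4 * (L / μ) * d ∧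
    0 ≤ tracePotential f (x (t + 1)) (corrected f M (x t) (G t)) ∧
    tracePotential f (x (t + 1)) (corrected f M (x t) (G t)) ≤ 5 / 4 * (L / μ) * d ∧
    newtonDecrement f (x t) ≤ newtonDecrement f x₀ ∧
    newtonDecrement f (x (t + 1)) = (1 + errBound (M * newtonDecrement f x₀) (L / μ) t) *
      contraction f (M * newtonDecrement f x₀) (L / μ) t (x t) (x (t + 1)) *
        newtonDecrement f (x t) ∧
    contraction f (M * newtonDecrement f x₀) (L / μ) t (x t) (x (t + 1)) ^ 2 ≤ 1 ∧
    (1 - 1 / (d : ℝ)) * tracePotential f (x (t + 1)) (corrected f M (x t) (G t))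
        + 4 * (d * (M * newtonDecrement f (x (t + 1))))
        + (1 - 1 / (2 * (d : ℝ))) ^ 2 * (1 - 4 / (5 * (L / μ))) *
          contraction f (M * newtonDecrement f x₀) (L / μ) t (x t) (x (t + 1)) ^ 2
      ≤ (1 - 1 / (2 * (d : ℝ))) ^ 2 * (1 + errBound (M * newtonDecrement f x₀) (L / μ) t) ^ 4 *
        (tracePotential f (x t) (G t) + 4 * (d * (M * newtonDecrement f (x t)))) := by
  have hκ := h.one_le_cond
  have hc := h.mul_decrement_nonneg
  have hμ := h.mu_pos
  have hM := h.M_pos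
  have hd := h.one_le_dim_real
  have hsmall := h.mul_decrement_cond_le
  obtain ⟨hG, hle, hge, hlam⟩ := hp.invariant h hx t
  have hinf := one_le_inflation hκ hc t
  have hinf5 := inflation_le hκ hc hsmall t
  have hinf5' := inflation_le hκ hc hsmall (t + 1)
  have hε0 := stepError_nonneg f h.M_pos.le (x t) (G t)
  have hεl := stepError_le h.M_pos.le (h.posDef_hess _) hG hle
  have he0 := errBound_nonneg hκ hc t
  have he1 := h.errBound_le t
  have hl0 := newtonDecrement_nonneg f (x t)
  have hl1 := newtonDecrement_nonneg f (x (t + 1))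
  have hl00 := newtonDecrement_nonneg f x₀
  have hθ0 := contraction_nonneg h t (x t) (x (t + 1))
  have hεe : stepError f M (x t) (G t) ≤ errBound (M * newtonDecrement f x₀) (L / μ) t := by
    have := mul_le_mul_of_nonneg_left hlam h.M_pos.le
    rw [errBound]
    linarith
  have hε1 := hεe.trans he1
  have hη : 1 ≤ L / μ * inflation (M * newtonDecrement f x₀) (L / μ) t :=
    one_le_mul_of_one_le_of_one_le hκ hinf
  obtain ⟨-, -, hĜ, hlow, hup⟩ := corrected_bounds h.smooth hμ h.M_pos.le h.concordant
    h.continuous_hess hG hle hη hge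
  obtain ⟨ϑ, hϑ0, hdec, hϑ, htr⟩ := exists_contraction h.smooth hμ h.M_pos.le h.concordant
    h.continuous_hess hG hle (by norm_num at hε1; linarith)
  rw [← hp.x_succ] at hlow hup hdec htr
  have hσ0 : 0 ≤ tracePotential f (x t) (G t) := by
    have := card_le_trace_inv_mul (h.posDef_hess (x t)) hG hle
    rw [Fintype.card_fin] at this
    exact sub_nonneg.2 this
  have hB0 : 0 ≤ tracePotential f (x (t + 1)) (corrected f M (x t) (G t)) := by
    have := card_le_trace_inv_mul (h.posDef_hess (x (t + 1))) hĜ.1 hlow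
    rw [Fintype.card_fin] at this
    exact sub_nonneg.2 this
  have hσ1 : tracePotential f (x t) (G t) ≤ 5 / 4 * (L / μ) * d := by
    have := trace_inv_mul_le_card (h.posDef_hess (x t)) hG hge
    rw [Fintype.card_fin] at this
    have h2 : L / μ * inflation (M * newtonDecrement f x₀) (L / μ) t * d
        ≤ L / μ * (5 / 4) * d := by gcongr
    unfold tracePotential
    linarith
  have hB1 : tracePotential f (x (t + 1)) (corrected f M (x t) (G t)) ≤ 5 / 4 * (L / μ) * d := by
    have := trace_inv_mul_le_card (h.posDef_hess (x (t + 1))) hĜ.1 hup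
    rw [Fintype.card_fin] at this
    have h2 : L / μ * inflation (M * newtonDecrement f x₀) (L / μ) t *
        (1 + stepError f M (x t) (G t)) ^ 4 * d ≤ L / μ * (5 / 4) * d := by
      rw [mul_assoc (L / μ)]
      gcongr
      refine le_trans ?_ hinf5'
      rw [inflation_succ]
      gcongr
    unfold tracePotential
    linarith
  have hlt0 : newtonDecrement f (x t) ≤ newtonDecrement f x₀ :=
    hlam.trans (mul_le_of_le_one_left hl00
      (pow_le_one₀ (linRate_nonneg hκ) (linRate_le_one hκ)))
  have heq : newtonDecrement f (x (t + 1)) = (1 + errBound (M * newtonDecrement f x₀) (L / μ) t) *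
      contraction f (M * newtonDecrement f x₀) (L / μ) t (x t) (x (t + 1)) *
        newtonDecrement f (x t) := by
    rcases hl0.eq_or_lt with h0 | h0
    · rw [← h0, mul_zero]
      rw [← h0] at hdec
      have : newtonDecrement f (x (t + 1)) ^ 2 ≤ 0 := by simpa using hdec
      exact pow_eq_zero_iff two_ne_zero |>.1 (le_antisymm this (sq_nonneg _))
    · unfold contraction
      field_simp
  have hθϑ : contraction f (M * newtonDecrement f x₀) (L / μ) t (x t) (x (t + 1)) ^ 2 ≤ ϑ := by
    rcases hl0.eq_or_lt with h0 | h0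
    · simpa [contraction, ← h0] using hϑ0
    · unfold contraction
      rw [div_pow, div_le_iff₀ (by positivity), mul_pow]
      calc _ ≤ _ := hdec
        _ ≤ (1 + errBound (M * newtonDecrement f x₀) (L / μ) t) ^ 2 * ϑ *
            newtonDecrement f (x t) ^ 2 := by gcongr
        _ = _ := by ring
  set σ := tracePotential f (x t) (G t) with hσ
  set B := tracePotential f (x (t + 1)) (corrected f M (x t) (G t)) with hB
  set ε := stepError f M (x t) (G t)
  set e := errBound (M * newtonDecrement f x₀) (L / μ) t
  set θ := contraction f (M * newtonDecrement f x₀) (L / μ) t (x t) (x (t + 1))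
  set l := newtonDecrement f (x t)
  have hm0 : 0 ≤ d * (M * l) := by positivity
  have hMl : M * l ≤ d * (M * l) := le_mul_of_one_le_left (by positivity) hd
  have hε1' : ε ≤ 0.01733 := hε1
  have hϑσ : ϑ ≤ σ + 2 * ε := by
    have := hϑ (1 + σ) (by linarith) (by
      have := quadForm_le_trace_mul (h.posDef_hess (x t)) hG hle
      rw [Fintype.card_fin] at this
      exact this)
    refine this.trans ?_
    rw [sub_le_iff_le_add, ← sub_le_iff_le_add', le_div_iff₀ (by positivity)]
    nlinarith [mul_nonneg hσ0 hε0, mul_nonneg (mul_nonneg hσ0 hε0) hε0,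
      mul_nonneg (mul_nonneg hσ0 hσ0) hε0]
  have hϑ1 : ϑ ≤ 1 := by
    refine (hϑ _ hη hge).trans ?_
    have : 0 ≤ (1 - ε) / (L / μ * inflation (M * newtonDecrement f x₀) (L / μ) t * (1 + ε)) := by
      have : 0 ≤ 1 - ε := by norm_num at hε1'; linarith
      positivity
    linarith
  refine ⟨hĜ, hσ0, hσ1, hB0, hB1, hlt0, heq, hθϑ.trans hϑ1, ?_⟩
  refine drift_inequality h.one_le_dim hκ hm0 ?_ he0 he1 hθ0 ?_ hσ0 hB0 ?_ ?_
  · refine le_trans ?_ h.small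
    gcongr
  · rw [heq]
    exact le_of_eq (by ring)
  · have h1 := trace_error_le h.one_le_dim hε0 hε1'
    have h2 : (1 + ε) ^ 4 * σ ≤ (1 + e) ^ 4 * σ := by gcongr
    have h3 : (d : ℝ) * ε ≤ d * (M * l) / 2 := by
      rw [mul_div_assoc]
      gcongr
    have h4 : ((hess f (x t))⁻¹ * G t).trace = σ + d := by rw [hσ, tracePotential]; ring
    rw [h4] at htr
    rw [hB, tracePotential]
    norm_num at h1 ⊢
    linarith
  · linarith

end Trajectory

/-! ### Gaussian directions and measurability -/

section Gaussian

variable {d : ℕ}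

theorem stdGaussian_singleton_zero (hd : 1 ≤ d) : stdGaussian (Vec d) {0} = 0 := by
  have : Nonempty (Fin d) := ⟨⟨0, hd⟩⟩
  have : NullSingletonClass (gaussianReal 0 1) := nullSingletonClass_gaussianReal one_ne_zero
  rw [← map_pi_eq_stdGaussian, Measure.map_apply (by fun_prop) (measurableSet_singleton _)]
  have e : (WithLp.toLp 2 : (Fin d → ℝ) → Vec d) ⁻¹' {0} = {0} := by
    ext v
    simp
  rw [e]
  exact measure_singleton _

theorem measurable_mul_div_norm_sq (i j : Fin d) :
    Measurable fun u : Vec d => u i * u j / ‖u‖ ^ 2 := by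
  fun_prop

theorem abs_mul_div_norm_sq_le (u : Vec d) (i j : Fin d) : |u i * u j / ‖u‖ ^ 2| ≤ 1 := by
  rw [abs_div, abs_of_nonneg (sq_nonneg ‖u‖), abs_mul]
  refine div_le_one_of_le₀ ?_ (sq_nonneg _)
  rw [sq]
  have h := fun k => PiLp.norm_apply_le u k
  simp only [Real.norm_eq_abs] at h
  exact mul_le_mul (h i) (h j) (abs_nonneg _) (norm_nonneg _)

theorem integrable_mul_div_norm_sq (i j : Fin d) :
    Integrable (fun u : Vec d => u i * u j / ‖u‖ ^ 2) (stdGaussian (Vec d)) :=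
  Integrable.of_bound (measurable_mul_div_norm_sq i j).aestronglyMeasurable 1
    (Filter.Eventually.of_forall fun u => abs_mul_div_norm_sq_le u i j)

theorem integral_comp_isometry (T : Vec d ≃ₗᵢ[ℝ] Vec d) (g : Vec d → ℝ) :
    ∫ u, g (T u) ∂stdGaussian (Vec d) = ∫ u, g u ∂stdGaussian (Vec d) := by
  conv_rhs => rw [← stdGaussian_map T]
  exact (T.toHomeomorph.measurableEmbedding.integral_map g).symm

/-- The matrix of second moments of the direction of a standard Gaussian vector is `1 / d` times the
identity, by invariance under sign changes and permutations of the coordinates. -/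
theorem integral_mul_div_norm_sq (hd : 1 ≤ d) (i j : Fin d) :
    ∫ u, u i * u j / ‖u‖ ^ 2 ∂stdGaussian (Vec d) = if i = j then 1 / (d : ℝ) else 0 := by
  split_ifs with hij
  · subst hij
    have hperm : ∀ k, ∫ u, u k * u k / ‖u‖ ^ 2 ∂stdGaussian (Vec d)
        = ∫ u, u i * u i / ‖u‖ ^ 2 ∂stdGaussian (Vec d) := fun k => by
      rw [← integral_comp_isometry (LinearIsometryEquiv.piLpCongrLeft 2 ℝ ℝ (Equiv.swap i k))]
      simp [LinearIsometryEquiv.piLpCongrLeft_apply]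
    have hsum : ∑ k, ∫ u, u k * u k / ‖u‖ ^ 2 ∂stdGaussian (Vec d) = 1 := by
      rw [← integral_finsetSum _ fun k _ => integrable_mul_div_norm_sq k k]
      have hae : (fun u : Vec d => ∑ k, u k * u k / ‖u‖ ^ 2) =ᵐ[stdGaussian (Vec d)]
          fun _ => 1 := by
        have h0 : ∀ᵐ u ∂stdGaussian (Vec d), u ≠ 0 := by
          rw [ae_iff]
          simpa using stdGaussian_singleton_zero hd
        filter_upwards [h0] with u hu
        rw [← Finset.sum_div, EuclideanSpace.real_norm_sq_eq]
        simp only [← sq]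
        rw [← EuclideanSpace.real_norm_sq_eq]
        exact div_self (by positivity)
      rw [integral_congr_ae hae]
      simp
    simp only [hperm, Finset.sum_const, Finset.card_univ, Fintype.card_fin, nsmul_eq_mul] at hsum
    rw [eq_div_iff (by positivity), mul_comm]
    exact hsum
  · set T : Vec d ≃ₗᵢ[ℝ] Vec d :=
      Submodule.reflection (Submodule.span ℝ {EuclideanSpace.single i 1})
    have hT : ∀ u k, T u k = if k = i then u k else -u k := fun u k => by
      simp only [T, Submodule.reflection_singleton_apply]
      split_ifs with h
      · subst h; simp [EuclideanSpace.inner_single_left]; ring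
      · simp [h]
    have h := integral_comp_isometry T fun u => u i * u j / ‖u‖ ^ 2
    simp only [hT, LinearIsometryEquiv.norm_map, if_true, if_neg (Ne.symm hij), mul_neg, neg_div,
      integral_neg] at h
    linarith

variable {Ω : Type*}

/-- Averaging a quadratic form over an independent Gaussian direction gives its normalized trace. -/
theorem integral_quadForm_div_norm_sq (hd : 1 ≤ d) {m mΩ : MeasurableSpace Ω}
    {P : Measure Ω} [IsProbabilityMeasure P] {Q : Ω → Mat d}
    (hQ : ∀ i j, Measurable[m] fun ω => Q ω i j) (hQi : ∀ i j, Integrable (fun ω => Q ω i j) P)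
    {u : Ω → Vec d} (hu : Measurable u) (hlaw : P.map u = stdGaussian (Vec d))
    (hind : Indep (MeasurableSpace.comap u inferInstance) m P) :
    Integrable (fun ω => (WithLp.ofLp (u ω) ⬝ᵥ (Q ω *ᵥ WithLp.ofLp (u ω))) / ‖u ω‖ ^ 2) P ∧
    ∫ ω, (WithLp.ofLp (u ω) ⬝ᵥ (Q ω *ᵥ WithLp.ofLp (u ω))) / ‖u ω‖ ^ 2 ∂P
      = 1 / (d : ℝ) * ∫ ω, (Q ω).trace ∂P := by
  have e : ∀ ω, (WithLp.ofLp (u ω) ⬝ᵥ (Q ω *ᵥ WithLp.ofLp (u ω))) / ‖u ω‖ ^ 2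
      = ∑ i, ∑ j, u ω i * u ω j / ‖u ω‖ ^ 2 * Q ω i j := fun ω => by
    simp only [dotProduct, mulVec, Finset.mul_sum, Finset.sum_div]
    exact Finset.sum_congr rfl fun i _ => Finset.sum_congr rfl fun j _ => by ring
  have hg : ∀ i j, Measurable fun ω => u ω i * u ω j / ‖u ω‖ ^ 2 := fun i j =>
    (measurable_mul_div_norm_sq i j).comp hu
  have hgi : ∀ i j, ∫ ω, u ω i * u ω j / ‖u ω‖ ^ 2 ∂P = if i = j then 1 / (d : ℝ) else 0 :=
    fun i j => by
      rw [← integral_mul_div_norm_sq hd i j, ← hlaw,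
        integral_map hu.aemeasurable (measurable_mul_div_norm_sq i j).aestronglyMeasurable]
  have hprod : ∀ i j, Integrable (fun ω => u ω i * u ω j / ‖u ω‖ ^ 2 * Q ω i j) P := fun i j =>
    (hQi i j).bdd_mul (hg i j).aestronglyMeasurable
      (Filter.Eventually.of_forall fun ω => abs_mul_div_norm_sq_le (u ω) i j)
  have hindep : ∀ i j, IndepFun (fun ω => u ω i * u ω j / ‖u ω‖ ^ 2) (fun ω => Q ω i j) P := by
    intro i j
    rw [IndepFun_iff_Indep]
    refine indep_of_indep_of_le_right (indep_of_indep_of_le_left hind ?_) (hQ i j).comap_le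
    exact ((measurable_mul_div_norm_sq i j).comp (comap_measurable u)).comap_le
  simp only [e]
  refine ⟨integrable_finsetSum _ fun i _ => integrable_finsetSum _ fun j _ => hprod i j, ?_⟩
  rw [integral_finsetSum _ fun i _ => integrable_finsetSum _ fun j _ => hprod i j]
  simp only [trace, diag]
  rw [integral_finsetSum _ fun i _ => hQi i i, Finset.mul_sum]
  refine Finset.sum_congr rfl fun i _ => ?_
  rw [integral_finsetSum _ fun j _ => hprod i j]
  have : ∀ j, ∫ ω, u ω i * u ω j / ‖u ω‖ ^ 2 * Q ω i j ∂P
      = (if i = j then 1 / (d : ℝ) else 0) * ∫ ω, Q ω i j ∂P := fun j => by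
    rw [(hindep i j).integral_fun_mul_eq_mul_integral (hg i j).aestronglyMeasurable
      (hQi i j).aestronglyMeasurable, hgi]
  simp [this]

end Gaussian

section RandomDirection

variable {d : ℕ}

theorem abs_apply_le_trace {Q : Mat d} (hQ : Q.PosSemidef) (i j : Fin d) : |Q i j| ≤ Q.trace := by
  have hdiag : ∀ k, Q k k ≤ Q.trace := fun k =>
    Finset.single_le_sum (f := fun k => Q k k) (fun k _ => hQ.diag_nonneg) (Finset.mem_univ k)
  have hs : Q j i = Q i j := by simpa using congrFun (congrFun hQ.1 i) j
  have h1 := hQ.dotProduct_mulVec_nonneg (Pi.single i 1 + Pi.single j 1)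
  have h2 := hQ.dotProduct_mulVec_nonneg (Pi.single i 1 - Pi.single j 1)
  simp [mulVec_add, mulVec_sub, add_dotProduct, dotProduct_add, sub_dotProduct, dotProduct_sub,
    hs] at h1 h2
  have hi := hdiag i
  have hj := hdiag j
  rw [abs_le]
  constructor <;> linarith

/-- If `B⁻¹ = Rᵀ R`, the BFGS update of `B` along `Rᵀ u` decreases `tr (A⁻¹ B)` by the quadratic
form of `R⁻ᵀ A⁻¹ R⁻¹` at the unit vector `u / ‖u‖`, up to the constant `1`. -/
theorem trace_bfgs_factor {A B R : Mat d} (hA : A.PosDef) (hB : B.PosDef) (hR : Rᵀ * R = B⁻¹)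
    {u : Vec d} (hu : u ≠ 0) :
    (A⁻¹ * bfgs A B (Rᵀ *ᵥ WithLp.ofLp u)).trace = (A⁻¹ * B).trace
      - (WithLp.ofLp u ⬝ᵥ (((R⁻¹)ᵀ * A⁻¹ * R⁻¹) *ᵥ WithLp.ofLp u)) / ‖u‖ ^ 2 + 1 := by
  have hdet : IsUnit R.det := by
    have h := (Matrix.isUnit_iff_isUnit_det _).1 hB.inv.isUnit
    rw [← hR, det_mul] at h
    exact isUnit_of_mul_isUnit_right h
  have hBR : B * Rᵀ = R⁻¹ := by
    have h1 : B * Rᵀ * R = 1 := by rw [Matrix.mul_assoc, hR, PosDef.mul_inv_cancel hB]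
    exact (inv_eq_left_inv h1).symm
  have hv : Rᵀ *ᵥ WithLp.ofLp u ≠ 0 := fun h => hu (by
    have h1 : (R⁻¹)ᵀ *ᵥ (Rᵀ *ᵥ WithLp.ofLp u) = WithLp.ofLp u := by
      rw [mulVec_mulVec, ← transpose_mul, mul_nonsing_inv _ hdet, transpose_one, one_mulVec]
    rw [h, mulVec_zero] at h1
    ext i
    simpa using (congrFun h1 i).symm)
  have h1 : B *ᵥ (Rᵀ *ᵥ WithLp.ofLp u) = R⁻¹ *ᵥ WithLp.ofLp u := by rw [mulVec_mulVec, hBR]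
  have h2 : (Rᵀ *ᵥ WithLp.ofLp u) ⬝ᵥ (R⁻¹ *ᵥ WithLp.ofLp u) = ‖u‖ ^ 2 := by
    rw [mulVec_transpose, ← Matrix.dotProduct_mulVec, mulVec_mulVec, mul_nonsing_inv _ hdet,
      one_mulVec, dotProduct_ofLp_self]
  have h3 : (R⁻¹ *ᵥ WithLp.ofLp u) ⬝ᵥ (A⁻¹ *ᵥ (R⁻¹ *ᵥ WithLp.ofLp u))
      = WithLp.ofLp u ⬝ᵥ (((R⁻¹)ᵀ * A⁻¹ * R⁻¹) *ᵥ WithLp.ofLp u) := by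
    rw [← mulVec_mulVec, ← mulVec_mulVec, Matrix.dotProduct_mulVec (WithLp.ofLp u),
      vecMul_transpose]
  rw [trace_inv_mul_bfgs hA hB hv, h1, h2, h3, inv_mul_eq_div]

theorem trace_factor {A B R : Mat d} (hB : B.PosDef) (hR : Rᵀ * R = B⁻¹) :
    ((R⁻¹)ᵀ * A⁻¹ * R⁻¹).trace = (A⁻¹ * B).trace := by
  have h : B = R⁻¹ * (R⁻¹)ᵀ := by
    rw [transpose_nonsing_inv, ← Matrix.mul_inv_rev, hR,
      nonsing_inv_nonsing_inv _ ((Matrix.isUnit_iff_isUnit_det _).1 hB.isUnit)]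
  rw [Matrix.mul_assoc, trace_mul_comm, Matrix.mul_assoc, ← h]

theorem posSemidef_factor {A : Mat d} (hA : A.PosDef) (R : Mat d) :
    ((R⁻¹)ᵀ * A⁻¹ * R⁻¹).PosSemidef := by
  simpa [conjTranspose_eq_transpose_of_trivial] using
    hA.inv.posSemidef.conjTranspose_mul_mul_same R⁻¹

end RandomDirection

section Measurability

variable {d : ℕ} {Ω : Type*} {m : MeasurableSpace Ω}

theorem measurable_mul_apply {A B : Ω → Mat d} (hA : ∀ i j, Measurable[m] fun ω => A ω i j)
    (hB : ∀ i j, Measurable[m] fun ω => B ω i j) (i j : Fin d) :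
    Measurable[m] fun ω => (A ω * B ω) i j := by
  simp only [Matrix.mul_apply]
  exact Finset.measurable_fun_sum _ fun k _ => (hA i k).mul (hB k j)

theorem measurable_mulVec {A : Ω → Mat d} (hA : ∀ i j, Measurable[m] fun ω => A ω i j)
    {v : Ω → Fin d → ℝ} (hv : Measurable[m] v) : Measurable[m] fun ω => A ω *ᵥ v ω :=
  measurable_pi_lambda _ fun i => by
    simp only [mulVec, dotProduct]
    exact Finset.measurable_fun_sum _ fun k _ => (hA i k).mul ((measurable_pi_apply k).comp hv)

theorem measurable_dotProduct {v w : Ω → Fin d → ℝ} (hv : Measurable[m] v)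
    (hw : Measurable[m] w) : Measurable[m] fun ω => v ω ⬝ᵥ w ω := by
  simp only [dotProduct]
  exact Finset.measurable_fun_sum _ fun k _ =>
    ((measurable_pi_apply k).comp hv).mul ((measurable_pi_apply k).comp hw)

theorem measurable_det {A : Ω → Mat d} (hA : ∀ i j, Measurable[m] fun ω => A ω i j) :
    Measurable[m] fun ω => (A ω).det := by
  simp only [det_apply']
  exact Finset.measurable_fun_sum _ fun σ _ => measurable_const.mul
    (Finset.measurable_fun_prod _ fun i _ => hA _ _)

theorem measurable_inv_apply {A : Ω → Mat d} (hA : ∀ i j, Measurable[m] fun ω => A ω i j)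
    (i j : Fin d) : Measurable[m] fun ω => (A ω)⁻¹ i j := by
  simp only [inv_def, Ring.inverse_eq_inv', Matrix.smul_apply, adjugate_apply, smul_eq_mul]
  refine (measurable_det hA).inv.mul (measurable_det fun k l => ?_)
  by_cases h : k = j
  · subst h; simp
  · simpa [updateRow_ne h] using hA k l

theorem measurable_trace {A : Ω → Mat d} (hA : ∀ i j, Measurable[m] fun ω => A ω i j) :
    Measurable[m] fun ω => (A ω).trace := by
  simp only [trace, diag]
  exact Finset.measurable_fun_sum _ fun i _ => hA i i

theorem measurable_bfgs_apply {A G : Ω → Mat d} (hA : ∀ i j, Measurable[m] fun ω => A ω i j)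
    (hG : ∀ i j, Measurable[m] fun ω => G ω i j) {v : Ω → Fin d → ℝ} (hv : Measurable[m] v)
    (i j : Fin d) : Measurable[m] fun ω => bfgs (A ω) (G ω) (v ω) i j := by
  have hvv : ∀ i j, Measurable[m] fun ω => vecMulVec (v ω) (v ω) i j := fun i j =>
    ((measurable_pi_apply i).comp hv).mul ((measurable_pi_apply j).comp hv)
  have key : ∀ {B : Ω → Mat d}, (∀ i j, Measurable[m] fun ω => B ω i j) →
      Measurable[m] fun ω => (v ω ⬝ᵥ (B ω *ᵥ v ω))⁻¹ *
        (B ω * vecMulVec (v ω) (v ω) * B ω) i j := fun hB =>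
    (measurable_dotProduct hv (measurable_mulVec hB hv)).inv.mul
      (measurable_mul_apply (measurable_mul_apply hB hvv) hB i j)
  exact ((hG i j).sub (key hG)).add (key hA)

theorem measurable_hess {f : Vec d → ℝ} {μ L M : ℝ} {x₀ : Vec d} (h : Assumptions f μ L M x₀)
    {y : Ω → Vec d} (hy : Measurable[m] y) (i j : Fin d) :
    Measurable[m] fun ω => hess f (y ω) i j :=
  (h.continuous_hess.matrix_elem i j).measurable.comp hy

end Measurability

/-! ### Expected decrease of the potential -/

section Run

variable {d : ℕ} {Ω : Type*} [mΩ : MeasurableSpace Ω] {P : Measure Ω} [IsProbabilityMeasure P]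
  {f : Vec d → ℝ} {μ L M : ℝ} {x₀ : Vec d} {ℱ : Filtration ℕ mΩ}
  {x : ℕ → Ω → Vec d} {G R : ℕ → Ω → Mat d} {u : ℕ → Ω → Vec d}

namespace IsRandomizedRun

omit [IsProbabilityMeasure P] in
theorem isPath (hrun : IsRandomizedRun P f L M x₀ ℱ x G R u) (ω : Ω) :
    IsPath f L M (fun t => x t ω) (fun t => G t ω) :=
  ⟨hrun.G_zero ω, fun t => hrun.x_succ t ω, fun t => ⟨_, hrun.G_succ t ω⟩⟩

omit [IsProbabilityMeasure P] in
theorem posDef_corrected (hrun : IsRandomizedRun P f L M x₀ ℱ x G R u)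
    (h : Assumptions f μ L M x₀) (t : ℕ) (ω : Ω) :
    (corrected f M (x t ω) (G t ω)).PosDef :=
  ((hrun.isPath ω).step h (hrun.x_zero ω) t).1

omit [IsProbabilityMeasure P] in
theorem measurable_corrected (hrun : IsRandomizedRun P f L M x₀ ℱ x G R u)
    (h : Assumptions f μ L M x₀) (t : ℕ) (i j : Fin d) :
    Measurable[ℱ t] fun ω => corrected f M (x t ω) (G t ω) i j := by
  -- the corrected matrix is recovered from its factor, which is measurable by assumption
  have e : ∀ ω, corrected f M (x t ω) (G t ω) = ((R t ω)ᵀ * R t ω)⁻¹ := fun ω => by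
    rw [hrun.R_factor, nonsing_inv_nonsing_inv _
      ((Matrix.isUnit_iff_isUnit_det _).1 (hrun.posDef_corrected h t ω).isUnit)]
  simp only [e]
  exact measurable_inv_apply (measurable_mul_apply (fun i j => hrun.R_measurable t j i)
    (hrun.R_measurable t)) i j

omit [IsProbabilityMeasure P] in
theorem measurable_x_succ (hrun : IsRandomizedRun P f L M x₀ ℱ x G R u)
    (h : Assumptions f μ L M x₀) {t : ℕ} (hx : Measurable[ℱ t] (x t))
    (hG : ∀ i j, Measurable[ℱ t] fun ω => G t ω i j) : Measurable[ℱ t] (x (t + 1)) := by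
  have e : x (t + 1) = fun ω => x t ω - WithLp.toLp 2 ((G t ω)⁻¹ *ᵥ grad f (x t ω)) := by
    funext ω
    exact hrun.x_succ t ω
  rw [e]
  refine hx.sub ((by fun_prop : Measurable (WithLp.toLp 2 : (Fin d → ℝ) → Vec d)).comp ?_)
  exact measurable_mulVec (measurable_inv_apply hG)
    (h.smooth.continuous_grad.measurable.comp hx)

omit [IsProbabilityMeasure P] in
theorem adapted (hrun : IsRandomizedRun P f L M x₀ ℱ x G R u) (h : Assumptions f μ L M x₀)
    (t : ℕ) : Measurable[ℱ t] (x t) ∧ ∀ i j, Measurable[ℱ t] fun ω => G t ω i j := by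
  induction t with
  | zero =>
    have e : x 0 = fun _ => x₀ := funext hrun.x_zero
    refine ⟨by rw [e]; exact measurable_const, fun i j => ?_⟩
    simp only [hrun.G_zero]
    exact measurable_const
  | succ t ih =>
    have hle := ℱ.mono t.le_succ
    have hx := hrun.measurable_x_succ h ih.1 ih.2
    refine ⟨hx.mono hle le_rfl, fun i j => ?_⟩
    simp only [hrun.G_succ]
    refine measurable_bfgs_apply (m := ℱ (t + 1)) (measurable_hess h (hx.mono hle le_rfl))
      (fun i j => (hrun.measurable_corrected h t i j).mono hle le_rfl) ?_ i j
    refine measurable_mulVec (fun i j => (hrun.R_measurable t j i).mono hle le_rfl) ?_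
    exact (by fun_prop : Measurable (WithLp.ofLp : Vec d → Fin d → ℝ)).comp (hrun.u_measurable t)

omit [IsProbabilityMeasure P] in
theorem measurable_newtonDecrement (hrun : IsRandomizedRun P f L M x₀ ℱ x G R u)
    (h : Assumptions f μ L M x₀) (t : ℕ) : Measurable fun ω => newtonDecrement f (x t ω) := by
  have hx := (hrun.adapted h t).1.mono (ℱ.le t) le_rfl
  have hg := h.smooth.continuous_grad.measurable.comp hx
  exact (measurable_dotProduct hg (measurable_mulVec
    (measurable_inv_apply (measurable_hess h hx)) hg)).sqrt

omit [IsProbabilityMeasure P] in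
theorem measurable_contraction (hrun : IsRandomizedRun P f L M x₀ ℱ x G R u)
    (h : Assumptions f μ L M x₀) (c κ : ℝ) (t : ℕ) :
    Measurable fun ω => contraction f c κ t (x t ω) (x (t + 1) ω) :=
  (hrun.measurable_newtonDecrement h (t + 1)).div
    ((hrun.measurable_newtonDecrement h t).const_mul _)

theorem integrable_newtonDecrement (hrun : IsRandomizedRun P f L M x₀ ℱ x G R u)
    (h : Assumptions f μ L M x₀) (t : ℕ) : Integrable (fun ω => newtonDecrement f (x t ω)) P := by
  refine Integrable.of_bound (hrun.measurable_newtonDecrement h t).aestronglyMeasurable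
    (newtonDecrement f x₀) (Filter.Eventually.of_forall fun ω => ?_)
  obtain ⟨-, -, -, -, -, hl, -⟩ := (hrun.isPath ω).step h (hrun.x_zero ω) t
  rw [Real.norm_eq_abs, abs_of_nonneg (newtonDecrement_nonneg _ _)]
  exact hl

theorem integrable_contraction_sq (hrun : IsRandomizedRun P f L M x₀ ℱ x G R u)
    (h : Assumptions f μ L M x₀) (t : ℕ) :
    Integrable (fun ω => contraction f (M * newtonDecrement f x₀) (L / μ) t
      (x t ω) (x (t + 1) ω) ^ 2) P := by
  refine Integrable.of_bound
    ((hrun.measurable_contraction h _ _ t).pow_const 2).aestronglyMeasurable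
    1 (Filter.Eventually.of_forall fun ω => ?_)
  obtain ⟨-, -, -, -, -, -, -, hθ, -⟩ := (hrun.isPath ω).step h (hrun.x_zero ω) t
  rw [Real.norm_eq_abs, abs_of_nonneg (sq_nonneg _)]
  exact hθ

theorem integrable_tracePotential (hrun : IsRandomizedRun P f L M x₀ ℱ x G R u)
    (h : Assumptions f μ L M x₀) (t : ℕ) :
    Integrable (fun ω => tracePotential f (x t ω) (G t ω)) P := by
  have hx := (hrun.adapted h t).1.mono (ℱ.le t) le_rfl
  have hG := fun i j => ((hrun.adapted h t).2 i j).mono (ℱ.le t) le_rfl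
  refine Integrable.of_bound ((measurable_trace (measurable_mul_apply
    (measurable_inv_apply (measurable_hess h hx)) hG)).sub_const _).aestronglyMeasurable
    (5 / 4 * (L / μ) * d) (Filter.Eventually.of_forall fun ω => ?_)
  obtain ⟨-, h0, h1, -⟩ := (hrun.isPath ω).step h (hrun.x_zero ω) t
  rw [Real.norm_eq_abs, abs_of_nonneg h0]
  exact h1

theorem integrable_tracePotential_corrected (hrun : IsRandomizedRun P f L M x₀ ℱ x G R u)
    (h : Assumptions f μ L M x₀) (t : ℕ) :
    Integrable (fun ω => tracePotential f (x (t + 1) ω) (corrected f M (x t ω) (G t ω))) P := by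
  have hx := (hrun.adapted h (t + 1)).1.mono (ℱ.le _) le_rfl
  have hG := fun i j => (hrun.measurable_corrected h t i j).mono (ℱ.le t) le_rfl
  refine Integrable.of_bound ((measurable_trace (measurable_mul_apply
    (measurable_inv_apply (measurable_hess h hx)) hG)).sub_const _).aestronglyMeasurable
    (5 / 4 * (L / μ) * d) (Filter.Eventually.of_forall fun ω => ?_)
  obtain ⟨-, -, -, h0, h1, -⟩ := (hrun.isPath ω).step h (hrun.x_zero ω) t
  rw [Real.norm_eq_abs, abs_of_nonneg h0]
  exact h1

/-- The BFGS update along the random direction contracts the expected trace potential exactly by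
`1 - 1 / d`, whatever the condition number. -/
theorem integral_tracePotential_succ (hrun : IsRandomizedRun P f L M x₀ ℱ x G R u)
    (h : Assumptions f μ L M x₀) (t : ℕ) :
    ∫ ω, tracePotential f (x (t + 1) ω) (G (t + 1) ω) ∂P = (1 - 1 / (d : ℝ)) *
      ∫ ω, tracePotential f (x (t + 1) ω) (corrected f M (x t ω) (G t ω)) ∂P := by
  have hd := h.one_le_dim_real
  set B : Ω → ℝ := fun ω => tracePotential f (x (t + 1) ω) (corrected f M (x t ω) (G t ω)) with hB
  set Q : Ω → Mat d := fun ω => ((R t ω)⁻¹)ᵀ * (hess f (x (t + 1) ω))⁻¹ * (R t ω)⁻¹ with hQ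
  have hBi : Integrable B P := hrun.integrable_tracePotential_corrected h t
  have hx := hrun.measurable_x_succ h (hrun.adapted h t).1 (hrun.adapted h t).2
  have hQm : ∀ i j, Measurable[ℱ t] fun ω => Q ω i j := by
    have hRi := measurable_inv_apply (hrun.R_measurable t)
    exact measurable_mul_apply (measurable_mul_apply (fun i j => hRi j i)
      (measurable_inv_apply (measurable_hess h hx))) hRi
  have hQt : ∀ ω, (Q ω).trace = B ω + d := fun ω => by
    simp only [hQ, hB, tracePotential]
    rw [trace_factor (hrun.posDef_corrected h t ω) (hrun.R_factor t ω)]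
    ring
  have hQi : ∀ i j, Integrable (fun ω => Q ω i j) P := fun i j => by
    refine (hBi.add (integrable_const (d : ℝ))).mono'
      ((hQm i j).mono (ℱ.le t) le_rfl).aestronglyMeasurable
      (Filter.Eventually.of_forall fun ω => ?_)
    rw [Real.norm_eq_abs, Pi.add_apply, ← hQt]
    exact abs_apply_le_trace (posSemidef_factor (h.posDef_hess _) _) i j
  have hum : Measurable (u t) := (hrun.u_measurable t).mono (ℱ.le _) le_rfl
  obtain ⟨hqi, hq⟩ := integral_quadForm_div_norm_sq h.one_le_dim hQm hQi hum
    (hrun.u_law t) (hrun.u_indep t)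
  have hu0 : ∀ᵐ ω ∂P, u t ω ≠ 0 := by
    have h0 := stdGaussian_singleton_zero h.one_le_dim
    rw [← hrun.u_law t, Measure.map_apply hum (measurableSet_singleton _)] at h0
    rw [ae_iff]
    simpa [Set.preimage] using h0
  have hae : (fun ω => tracePotential f (x (t + 1) ω) (G (t + 1) ω)) =ᵐ[P] fun ω =>
      B ω + 1 - (WithLp.ofLp (u t ω) ⬝ᵥ (Q ω *ᵥ WithLp.ofLp (u t ω))) / ‖u t ω‖ ^ 2 := by
    filter_upwards [hu0] with ω hω
    simp only [tracePotential, hB, hQ]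
    rw [hrun.G_succ, trace_bfgs_factor (h.posDef_hess _) (hrun.posDef_corrected h t ω)
      (hrun.R_factor t ω) hω]
    ring
  have hBd : ∫ ω, (Q ω).trace ∂P = (∫ ω, B ω ∂P) + d := by
    simp only [hQt]
    rw [integral_add hBi (integrable_const _)]
    simp
  have hB1 : Integrable (fun ω => B ω + 1) P := hBi.add (integrable_const _)
  rw [integral_congr_ae hae, integral_sub hB1 hqi, hq, hBd,
    integral_add hBi (integrable_const _)]
  simp only [integral_const, probReal_univ, smul_eq_mul, mul_one]
  field_simp
  ring

/-- The expected potential `σ_t + 4 d M λ_t`, where `σ_t` is the trace potential, decreases by the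
factor `(1 - 1 / (2 d))²` up to the inflation of the iteration, with a surplus proportional to the
expectation of `θ_t²`. -/
theorem integral_potential_succ_le (hrun : IsRandomizedRun P f L M x₀ ℱ x G R u)
    (h : Assumptions f μ L M x₀) (t : ℕ) :
    ∫ ω, (tracePotential f (x (t + 1) ω) (G (t + 1) ω)
        + 4 * (d * (M * newtonDecrement f (x (t + 1) ω)))) ∂P
      + (1 - 1 / (2 * (d : ℝ))) ^ 2 * (1 - 4 / (5 * (L / μ))) *
        ∫ ω, contraction f (M * newtonDecrement f x₀) (L / μ) t (x t ω) (x (t + 1) ω) ^ 2 ∂P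
    ≤ (1 - 1 / (2 * (d : ℝ))) ^ 2 * (1 + errBound (M * newtonDecrement f x₀) (L / μ) t) ^ 4 *
      ∫ ω, (tracePotential f (x t ω) (G t ω) + 4 * (d * (M * newtonDecrement f (x t ω)))) ∂P := by
  have i1 := hrun.integrable_tracePotential_corrected h t
  have i2 := fun t => (((hrun.integrable_newtonDecrement h t).const_mul M).const_mul
    (d : ℝ)).const_mul 4
  have i3 := hrun.integrable_contraction_sq h t
  have i4 := hrun.integrable_tracePotential h
  have i5 : Integrable (fun ω => (1 - 1 / (d : ℝ)) *
      tracePotential f (x (t + 1) ω) (corrected f M (x t ω) (G t ω))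
      + 4 * (d * (M * newtonDecrement f (x (t + 1) ω)))) P := (i1.const_mul _).add (i2 (t + 1))
  have i6 := i3.const_mul ((1 - 1 / (2 * (d : ℝ))) ^ 2 * (1 - 4 / (5 * (L / μ))))
  rw [integral_add (i4 (t + 1)) (i2 (t + 1)), hrun.integral_tracePotential_succ h t,
    ← integral_const_mul, ← integral_const_mul, ← integral_const_mul,
    ← integral_add (i1.const_mul _) (i2 (t + 1)), ← integral_add i5 i6]
  refine integral_mono (i5.add i6) (((i4 t).add (i2 t)).const_mul _) fun ω => ?_
  obtain ⟨-, -, -, -, -, -, -, -, hdrift⟩ := (hrun.isPath ω).step h (hrun.x_zero ω) t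
  exact hdrift

theorem integral_potential_zero_le (hrun : IsRandomizedRun P f L M x₀ ℱ x G R u)
    (h : Assumptions f μ L M x₀) :
    ∫ ω, (tracePotential f (x 0 ω) (G 0 ω) + 4 * (d * (M * newtonDecrement f (x 0 ω)))) ∂P
      ≤ d * (L / μ - 4 / 5) := by
  have hκ := h.one_le_cond
  have hd := h.one_le_dim_real
  have hc := h.mul_decrement_nonneg
  have hσ : tracePotential f x₀ (L • (1 : Mat d)) ≤ L / μ * d - d := by
    have := trace_inv_mul_le_card (h.posDef_hess x₀) (PosDef.one.smul h.L_pos).1 (c := L / μ)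
      (fun v => by
        have h1 := h.smooth.le_quadForm_hess x₀ v
        have hμ := h.mu_pos
        rw [smul_mulVec, one_mulVec, dotProduct_smul, smul_eq_mul, div_mul_eq_mul_div,
          le_div_iff₀ hμ]
        nlinarith [h.L_pos])
    rw [Fintype.card_fin] at this
    unfold tracePotential
    linarith
  have hm : d * (M * newtonDecrement f x₀) ≤ 0.03466 := by
    refine le_trans ?_ h.small
    exact le_mul_of_one_le_right (by positivity) hκ
  simp only [hrun.x_zero, hrun.G_zero, integral_const, probReal_univ, one_smul]
  norm_num at hm
  linarith

/-- The weighted contraction factors have bounded total expectation. -/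
theorem sum_integral_contraction_sq_le (hrun : IsRandomizedRun P f L M x₀ ℱ x G R u)
    (h : Assumptions f μ L M x₀) (t : ℕ) :
    ∑ i ∈ Finset.range t, ∫ ω, (((1 - 1 / (2 * (d : ℝ))) ^ 2) ^ i)⁻¹ *
      contraction f (M * newtonDecrement f x₀) (L / μ) i (x i ω) (x (i + 1) ω) ^ 2 ∂P
      ≤ 5 / 4 * (d * (L / μ)) := by
  have hκ := h.one_le_cond
  have hd := h.one_le_dim_real
  have hc := h.mul_decrement_nonneg
  simp only [integral_const_mul]
  set q := (1 - 1 / (2 * (d : ℝ))) ^ 2 with hq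
  set V : ℕ → ℝ := fun t =>
    ∫ ω, (tracePotential f (x t ω) (G t ω) + 4 * (d * (M * newtonDecrement f (x t ω)))) ∂P with hV
  set T : ℕ → ℝ := fun t =>
    ∫ ω, contraction f (M * newtonDecrement f x₀) (L / μ) t (x t ω) (x (t + 1) ω) ^ 2 ∂P with hT
  set c := 1 - 4 / (5 * (L / μ)) with hcdef
  have hc0 : 0 < c := by
    have : 4 / (5 * (L / μ)) < 1 := by rw [div_lt_one (by positivity)]; linarith
    rw [hcdef]; linarith
  have hq0 : 0 < q := by
    have : 1 / (2 * (d : ℝ)) < 1 := by rw [div_lt_one (by positivity)]; linarith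
    have : 0 < 1 - 1 / (2 * (d : ℝ)) := by linarith
    positivity
  have hV0 : ∀ t, 0 ≤ V t := fun t => integral_nonneg fun ω => by
    obtain ⟨-, h0, -⟩ := (hrun.isPath ω).step h (hrun.x_zero ω) t
    have h1 := mul_nonneg h.M_pos.le (newtonDecrement_nonneg f (x t ω))
    have h2 : 0 ≤ 4 * (d * (M * newtonDecrement f (x t ω))) := by positivity
    exact add_nonneg h0 h2
  have hT0 : ∀ t, 0 ≤ T t := fun t => integral_nonneg fun ω => sq_nonneg _
  have hrec : ∀ t, V t * (q ^ t)⁻¹ + c * ∑ i ∈ Finset.range t, (q ^ i)⁻¹ * T i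
      ≤ inflation (M * newtonDecrement f x₀) (L / μ) t * V 0 := by
    intro t
    induction t with
    | zero => simp [inflation]
    | succ t ih =>
      have hs : V (t + 1) + q * c * T t ≤ q * (1 + errBound (M * newtonDecrement f x₀)
          (L / μ) t) ^ 4 * V t := hrun.integral_potential_succ_le h t
      have he := errBound_nonneg hκ hc t
      set a := (1 + errBound (M * newtonDecrement f x₀) (L / μ) t) ^ 4 with ha
      have ha1 : 1 ≤ a := one_le_pow₀ (by linarith)
      have hS : 0 ≤ c * ∑ i ∈ Finset.range t, (q ^ i)⁻¹ * T i :=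
        mul_nonneg hc0.le (Finset.sum_nonneg fun i _ => mul_nonneg (by positivity) (hT0 i))
      have h1 : V (t + 1) * (q ^ (t + 1))⁻¹ + c * ((q ^ t)⁻¹ * T t) ≤ a * (V t * (q ^ t)⁻¹) := by
        have := mul_le_mul_of_nonneg_right hs (by positivity : 0 ≤ (q ^ (t + 1))⁻¹)
        calc _ = (V (t + 1) + q * c * T t) * (q ^ (t + 1))⁻¹ := by rw [pow_succ]; field_simp
          _ ≤ _ := this
          _ = _ := by rw [pow_succ]; field_simp
      rw [Finset.sum_range_succ, mul_add, inflation_succ, ← ha]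
      calc _ ≤ a * (V t * (q ^ t)⁻¹) + 1 * (c * ∑ i ∈ Finset.range t, (q ^ i)⁻¹ * T i) := by
            linarith
        _ ≤ a * (V t * (q ^ t)⁻¹) + a * (c * ∑ i ∈ Finset.range t, (q ^ i)⁻¹ * T i) := by gcongr
        _ = a * (V t * (q ^ t)⁻¹ + c * ∑ i ∈ Finset.range t, (q ^ i)⁻¹ * T i) := by ring
        _ ≤ a * (inflation (M * newtonDecrement f x₀) (L / μ) t * V 0) := by gcongr
        _ = _ := by ring
  have h1 : c * ∑ i ∈ Finset.range t, (q ^ i)⁻¹ * T i ≤ 5 / 4 * (d * (L / μ - 4 / 5)) := by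
    have h2 : 0 ≤ V t * (q ^ t)⁻¹ := mul_nonneg (hV0 t) (by positivity)
    calc _ ≤ inflation (M * newtonDecrement f x₀) (L / μ) t * V 0 := by linarith [hrec t]
      _ ≤ 5 / 4 * V 0 := by
          gcongr
          · exact hV0 0
          · exact inflation_le hκ hc h.mul_decrement_cond_le t
      _ ≤ _ := by
          gcongr
          exact hrun.integral_potential_zero_le h
  have h2 : 5 / 4 * (d * (L / μ - 4 / 5)) = c * (5 / 4 * (d * (L / μ))) := by
    have : L / μ ≠ 0 := by positivity
    rw [hcdef]
    generalize L / μ = κ at *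
    field_simp
  rw [h2] at h1
  exact le_of_mul_le_mul_left h1 hc0

/-- The event that the weighted contraction factors sum to at most `1 / δ` times the bound for their
expectation has probability at least `1 - δ`. -/
theorem le_measure_sum_contraction_sq_le (hrun : IsRandomizedRun P f L M x₀ ℱ x G R u)
    (h : Assumptions f μ L M x₀) {δ : ℝ} (hδ : 0 < δ) :
    ENNReal.ofReal (1 - δ) ≤ P {ω | ∀ t, ∑ i ∈ Finset.range t,
      (((1 - 1 / (2 * (d : ℝ))) ^ 2) ^ i)⁻¹ *
        contraction f (M * newtonDecrement f x₀) (L / μ) i (x i ω) (x (i + 1) ω) ^ 2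
      ≤ 5 / 4 * (d * (L / μ)) / δ} := by
  have hκ := h.one_le_cond
  have hd := h.one_le_dim_real
  set g : ℕ → Ω → ℝ := fun i ω => (((1 - 1 / (2 * (d : ℝ))) ^ 2) ^ i)⁻¹ *
    contraction f (M * newtonDecrement f x₀) (L / μ) i (x i ω) (x (i + 1) ω) ^ 2 with hg
  set K := 5 / 4 * (d * (L / μ)) with hK
  have hK0 : 0 < K := by positivity
  have hg0 : ∀ i ω, 0 ≤ g i ω := fun i ω => by
    simp only [hg]
    positivity
  have hgm : ∀ i, Measurable (g i) := fun i =>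
    ((hrun.measurable_contraction h _ _ i).pow_const 2).const_mul _
  have hgi : ∀ i, Integrable (g i) P := fun i => (hrun.integrable_contraction_sq h i).const_mul _
  set S : Ω → ENNReal := fun ω => ∑' i, ENNReal.ofReal (g i ω) with hS
  have hSm : Measurable S := Measurable.tsum fun i => (hgm i).ennreal_ofReal
  have hSint : ∫⁻ ω, S ω ∂P ≤ ENNReal.ofReal K := by
    rw [lintegral_tsum fun i => (hgm i).ennreal_ofReal.aemeasurable]
    refine ENNReal.tsum_le_of_sum_range_le fun t => ?_
    simp only [← ofReal_integral_eq_lintegral_ofReal (hgi _)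
      (Filter.Eventually.of_forall (hg0 _))]
    rw [← ENNReal.ofReal_sum_of_nonneg fun i _ => integral_nonneg (hg0 i)]
    exact ENNReal.ofReal_le_ofReal (hrun.sum_integral_contraction_sq_le h t)
  set a := ENNReal.ofReal (K / δ) with ha
  have hmarkov : P {ω | a ≤ S ω} ≤ ENNReal.ofReal δ := by
    refine (meas_ge_le_lintegral_div hSm.aemeasurable
      (ENNReal.ofReal_pos.2 (by positivity)).ne' ENNReal.ofReal_ne_top).trans ?_
    refine (ENNReal.div_le_div_right hSint _).trans (le_of_eq ?_)
    rw [← ENNReal.ofReal_div_of_pos (by positivity)]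
    congr 1
    field_simp
  have hmeas : MeasurableSet {ω | a ≤ S ω} := measurableSet_le measurable_const hSm
  calc ENNReal.ofReal (1 - δ) = 1 - ENNReal.ofReal δ := by
        rw [ENNReal.ofReal_sub _ hδ.le, ENNReal.ofReal_one]
    _ ≤ 1 - P {ω | a ≤ S ω} := tsub_le_tsub_left hmarkov 1
    _ = P {ω | a ≤ S ω}ᶜ := (prob_compl_eq_one_sub hmeas).symm
    _ ≤ _ := by
        refine measure_mono ?_
        intro ω hω t
        have h1 : S ω < a := not_le.1 hω
        have h2 : ENNReal.ofReal (∑ i ∈ Finset.range t, g i ω) ≤ a := by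
          rw [ENNReal.ofReal_sum_of_nonneg fun i _ => hg0 i ω]
          exact (ENNReal.sum_le_tsum _).trans h1.le
        exact (ENNReal.ofReal_le_ofReal_iff (by positivity)).1 h2

end IsRandomizedRun

end Run

/-! ### From the sum of the factors to the superlinear rate -/

section Rates

theorem prod_sq_le_of_weighted_sum_le {ρ K : ℝ} (hρ : 0 < ρ) {θ : ℕ → ℝ} {t : ℕ}
    (ht : 1 ≤ t) (hsum : ∑ i ∈ Finset.range t, ((ρ ^ 2) ^ i)⁻¹ * θ i ^ 2 ≤ K) :
    ∏ i ∈ Finset.range t, θ i ^ 2 ≤ (K / t) ^ t * (ρ ^ 2) ^ ∑ i ∈ Finset.range t, i := by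
  have ht0 : (0 : ℝ) < t := by exact_mod_cast ht
  set z : ℕ → ℝ := fun i => ((ρ ^ 2) ^ i)⁻¹ * θ i ^ 2 with hz
  have hz0 : ∀ i, 0 ≤ z i := fun i => by simp only [hz]; positivity
  have h1 := Real.geom_mean_le_arith_mean (Finset.range t) (fun _ => (1 : ℝ)) z
    (fun _ _ => zero_le_one) (by simpa using ht0) fun i _ => hz0 i
  simp only [Real.rpow_one, one_mul, Finset.sum_const, Finset.card_range, nsmul_eq_mul,
    mul_one] at h1
  have hp0 : 0 ≤ ∏ i ∈ Finset.range t, z i := Finset.prod_nonneg fun i _ => hz0 i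
  have h2 : ∏ i ∈ Finset.range t, z i ≤ (K / t) ^ t := by
    calc ∏ i ∈ Finset.range t, z i
        = ((∏ i ∈ Finset.range t, z i) ^ (t : ℝ)⁻¹) ^ t := by
          rw [← Real.rpow_natCast, ← Real.rpow_mul hp0, inv_mul_cancel₀ ht0.ne', Real.rpow_one]
      _ ≤ _ := by
          gcongr
          exact h1.trans (by gcongr)
  calc ∏ i ∈ Finset.range t, θ i ^ 2
      = (∏ i ∈ Finset.range t, z i) * (ρ ^ 2) ^ ∑ i ∈ Finset.range t, i := by
        rw [← Finset.prod_pow_eq_pow_sum, ← Finset.prod_mul_distrib]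
        refine Finset.prod_congr rfl fun i _ => ?_
        simp only [hz]
        field_simp
    _ ≤ _ := by gcongr

/-- A bound on the weighted sum of the squared factors bounds their product, by the
arithmetic-geometric mean inequality. The weights contribute the power `t (t - 1) / 2` of `ρ`. -/
theorem prod_le_of_weighted_sum_le {ρ K : ℝ} (hρ : 0 < ρ) (hK : 0 ≤ K) {θ : ℕ → ℝ}
    {t : ℕ} (ht : 1 ≤ t)
    (hsum : ∑ i ∈ Finset.range t, ((ρ ^ 2) ^ i)⁻¹ * θ i ^ 2 ≤ K) :
    ∏ i ∈ Finset.range t, θ i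
      ≤ ρ ^ ((t : ℝ) * ((t : ℝ) - 1) / 2) * (K / t) ^ ((t : ℝ) / 2) := by
  have hKt : 0 ≤ K / t := by positivity
  refine le_of_sq_le_sq ?_ (by positivity)
  rw [← Finset.prod_pow]
  refine (prod_sq_le_of_weighted_sum_le hρ ht hsum).trans_eq ?_
  have hs : ((∑ i ∈ Finset.range t, i : ℕ) : ℝ) = (t : ℝ) * ((t : ℝ) - 1) / 2 := by
    clear ht hsum hKt
    induction t with
    | zero => simp
    | succ t ih => rw [Finset.sum_range_succ, Nat.cast_add, ih]; push_cast; ring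
  rw [mul_pow, ← hs, Real.rpow_natCast, ← Real.rpow_mul_natCast hKt, ← pow_mul, ← pow_mul,
    mul_comm 2, mul_comm, ← Real.rpow_natCast (K / t) t]
  congr 2
  push_cast
  ring

variable {d : ℕ} {L μ : ℝ}

theorem rate_eq {ρ κ C : ℝ} (hρ : ρ = 1 - 1 / (2 * (d : ℝ))) (hκ : κ = L / μ) (t : ℕ) :
    rate C d L μ t
      = 2 * ρ ^ ((t : ℝ) * ((t : ℝ) - 1) / 4) * (C * d * κ / t) ^ ((t : ℝ) / 2) := by
  rw [rate, hρ, hκ]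
  congr 2
  rw [mul_div_assoc', div_div, mul_comm μ]

/-- A bound with the full power `t (t - 1) / 2` of `ρ` is at least as good as the rate with half
that power, once the other half compensates for the ratio of the constants. -/
theorem bound_le_rate {ρ κ C K : ℝ} (hρ : ρ = 1 - 1 / (2 * (d : ℝ))) (hρ0 : 0 < ρ)
    (hκ : κ = L / μ) (hK : 0 ≤ K) (t : ℕ)
    (h : ρ ^ (((t : ℝ) - 1) / 2) * K ≤ C * d * κ) :
    2 * (ρ ^ ((t : ℝ) * ((t : ℝ) - 1) / 2) * (K / t) ^ ((t : ℝ) / 2)) ≤ rate C d L μ t := by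
  have hρt : 0 ≤ ρ ^ (((t : ℝ) - 1) / 2) := (Real.rpow_pos_of_pos hρ0 _).le
  rw [rate_eq hρ hκ, mul_assoc]
  have e : ρ ^ ((t : ℝ) * ((t : ℝ) - 1) / 2)
      = ρ ^ ((t : ℝ) * ((t : ℝ) - 1) / 4) * (ρ ^ (((t : ℝ) - 1) / 2)) ^ ((t : ℝ) / 2) := by
    rw [← Real.rpow_mul hρ0.le, ← Real.rpow_add hρ0]
    congr 1
    ring
  rw [e, mul_assoc, ← Real.mul_rpow hρt (by positivity)]
  gcongr
  rw [mul_div_assoc']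
  gcongr

theorem one_le_rate {ρ κ C : ℝ} (hρ : ρ = 1 - 1 / (2 * (d : ℝ))) (hρ0 : 0 < ρ)
    (hκ : κ = L / μ) {t : ℕ} (ht : 1 ≤ t) (h0 : 0 ≤ C * d * κ)
    (h : (t : ℝ) ≤ ρ ^ (((t : ℝ) - 1) / 2) * (C * d * κ)) :
    1 ≤ rate C d L μ t := by
  have ht0 : (0 : ℝ) < t := by exact_mod_cast ht
  have hρt : 0 ≤ ρ ^ (((t : ℝ) - 1) / 2) := (Real.rpow_pos_of_pos hρ0 _).le
  have e : ρ ^ ((t : ℝ) * ((t : ℝ) - 1) / 4) = (ρ ^ (((t : ℝ) - 1) / 2)) ^ ((t : ℝ) / 2) := by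
    rw [← Real.rpow_mul hρ0.le]
    congr 1
    ring
  rw [rate_eq hρ hκ, mul_assoc, e, ← Real.mul_rpow hρt (by positivity)]
  have h1 : 1 ≤ (ρ ^ (((t : ℝ) - 1) / 2) * (C * d * κ / t)) ^ ((t : ℝ) / 2) := by
    refine Real.one_le_rpow ?_ (by positivity)
    rw [mul_div_assoc', le_div_iff₀ ht0, one_mul]
    exact h
  linarith

theorem rpow_half_le_exp {ρ : ℝ} (hρ : ρ = 1 - 1 / (2 * (d : ℝ))) (hρ0 : 0 ≤ ρ) {t : ℕ}
    (ht : 1 ≤ t) : ρ ^ (((t : ℝ) - 1) / 2) ≤ Real.exp (-(((t : ℝ) - 1) / (4 * d))) := by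
  have ht1 : (1 : ℝ) ≤ t := by exact_mod_cast ht
  have h1 : ρ ≤ Real.exp (-(1 / (2 * (d : ℝ)))) := by
    have := Real.add_one_le_exp (-(1 / (2 * (d : ℝ))))
    linarith
  refine (Real.rpow_le_rpow hρ0 h1 (by linarith)).trans_eq ?_
  rw [← Real.exp_mul]
  congr 1
  rw [show (4 : ℝ) * d = 2 * d * 2 by ring, ← div_div]
  ring

end Rates

section Conclusion

variable {d : ℕ} {f : Vec d → ℝ} {μ L M : ℝ} {x₀ : Vec d}

theorem IsPath.decrement_eq_prod (h : Assumptions f μ L M x₀) {x : ℕ → Vec d} {G : ℕ → Mat d}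
    (hp : IsPath f L M x G) (hx : x 0 = x₀) (t : ℕ) :
    newtonDecrement f (x t) = (∏ i ∈ Finset.range t,
        (1 + errBound (M * newtonDecrement f x₀) (L / μ) i)) *
      (∏ i ∈ Finset.range t,
        contraction f (M * newtonDecrement f x₀) (L / μ) i (x i) (x (i + 1))) *
      newtonDecrement f x₀ := by
  induction t with
  | zero => simp [hx]
  | succ t ih =>
    obtain ⟨-, -, -, -, -, -, heq, -⟩ := hp.step h hx t
    rw [heq, Finset.prod_range_succ, Finset.prod_range_succ]
    linear_combination (1 + errBound (M * newtonDecrement f x₀) (L / μ) t) *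
      contraction f (M * newtonDecrement f x₀) (L / μ) t (x t) (x (t + 1)) * ih

/-- A bound `K` on the weighted sum of the contraction factors gives superlinear convergence. -/
theorem IsPath.decrement_le_of_sum_le (h : Assumptions f μ L M x₀) {x : ℕ → Vec d}
    {G : ℕ → Mat d} (hp : IsPath f L M x G) (hx : x 0 = x₀) {K : ℝ} (hK : 0 ≤ K) {t : ℕ}
    (ht : 1 ≤ t)
    (hsum : ∑ i ∈ Finset.range t, (((1 - 1 / (2 * (d : ℝ))) ^ 2) ^ i)⁻¹ *
      contraction f (M * newtonDecrement f x₀) (L / μ) i (x i) (x (i + 1)) ^ 2 ≤ K)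
    {C : ℝ} (hC : (1 - 1 / (2 * (d : ℝ))) ^ (((t : ℝ) - 1) / 2) * K ≤ C * d * (L / μ)) :
    newtonDecrement f (x t) ≤ rate C d L μ t * newtonDecrement f x₀ := by
  have hd := h.one_le_dim_real
  have hρ0 : 0 < 1 - 1 / (2 * (d : ℝ)) := by
    have : 1 / (2 * (d : ℝ)) < 1 := by rw [div_lt_one (by positivity)]; linarith
    linarith
  have h0 := newtonDecrement_nonneg f x₀
  have hprod := prod_le_of_weighted_sum_le hρ0 hK ht hsum
  have herr := prod_one_add_errBound_le h.one_le_cond h.mul_decrement_nonneg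
    h.mul_decrement_cond_le t
  have hpn : 0 ≤ ∏ i ∈ Finset.range t,
      contraction f (M * newtonDecrement f x₀) (L / μ) i (x i) (x (i + 1)) :=
    Finset.prod_nonneg fun i _ => contraction_nonneg h i _ _
  rw [hp.decrement_eq_prod h hx t]
  gcongr
  exact (mul_le_mul herr hprod hpn zero_le_two).trans (bound_le_rate rfl hρ0 rfl hK t hC)

end Conclusion

end SharpenedBFGS

theorem mainTheorem7 {d : ℕ} (hd : 1 ≤ d)
    {Ω : Type*} [mΩ : MeasurableSpace Ω] (P : Measure Ω) [IsProbabilityMeasure P]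
    (f : SharpenedBFGS.Vec d → ℝ) (μ L M : ℝ) (hμ : 0 < μ) (hL : 0 < L) (hM : 0 < M)
    (hf : SharpenedBFGS.StronglyConvexSmooth f μ L)
    (hsc : SharpenedBFGS.StronglySelfConcordant f M)
    (x₀ : SharpenedBFGS.Vec d)
    (hx₀ : SharpenedBFGS.newtonDecrement f x₀ ≤ Real.log 2 / 20 * μ / ((d : ℝ) * M * L))
    (ℱ : Filtration ℕ mΩ)
    (x : ℕ → Ω → SharpenedBFGS.Vec d) (G R : ℕ → Ω → SharpenedBFGS.Mat d)
    (u : ℕ → Ω → SharpenedBFGS.Vec d)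
    (hrun : SharpenedBFGS.IsRandomizedRun P f L M x₀ ℱ x G R u) :
    ENNReal.ofReal (1 - (1 + Real.log (L / μ)) / (10 * (L / μ))) ≤
      P {ω | ∀ t : ℕ, 1 ≤ t →
        SharpenedBFGS.newtonDecrement f (x t ω) ≤
          SharpenedBFGS.rate 8 d L μ t * SharpenedBFGS.newtonDecrement f x₀} ∧
    ∀ δ : ℝ, 0 < δ → δ < 1 →
      ENNReal.ofReal (1 - δ) ≤
        P {ω | ∀ t : ℕ, 1 ≤ t →
          SharpenedBFGS.newtonDecrement f (x t ω) ≤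
            SharpenedBFGS.rate (8 / δ) d L μ t * SharpenedBFGS.newtonDecrement f x₀ ∧
          (1 + 4 * (d : ℝ) * Real.log (1 / δ) ≤ (t : ℝ) →
            SharpenedBFGS.newtonDecrement f (x t ω) ≤
              SharpenedBFGS.rate 8 d L μ t * SharpenedBFGS.newtonDecrement f x₀)} := by
  have hd1 : (1 : ℝ) ≤ d := by exact_mod_cast hd
  have h : SharpenedBFGS.Assumptions f μ L M x₀ := by
    refine ⟨hd, hμ, hL, hM, hf, hsc, ?_⟩
    rw [le_div_iff₀ (by positivity)] at hx₀
    have h2 := Real.log_two_lt_d9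
    have e : d * (M * SharpenedBFGS.newtonDecrement f x₀) * (L / μ)
        = SharpenedBFGS.newtonDecrement f x₀ * (d * M * L) / μ := by ring
    rw [e, div_le_iff₀ hμ]
    refine hx₀.trans ?_
    gcongr
    norm_num at h2 ⊢
    linarith
  have hκ := h.one_le_cond
  have hκ0 : 0 < L / μ := by positivity
  have hlog := Real.log_nonneg hκ
  have hρ0 : 0 < 1 - 1 / (2 * (d : ℝ)) := by
    have : 1 / (2 * (d : ℝ)) < 1 := by rw [div_lt_one (by positivity)]; linarith
    linarith
  have hρ1 : 1 - 1 / (2 * (d : ℝ)) ≤ 1 := by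
    have : 0 ≤ 1 / (2 * (d : ℝ)) := by positivity
    linarith
  refine ⟨?_, fun δ hδ hδ1 => ?_⟩
  · set δ := (1 + Real.log (L / μ)) / (10 * (L / μ)) with hδdef
    have hδ : 0 < δ := by positivity
    refine (hrun.le_measure_sum_contraction_sq_le h hδ).trans (measure_mono ?_)
    intro ω hω t ht
    have hl0 := SharpenedBFGS.newtonDecrement_nonneg f x₀
    have ht1 : (1 : ℝ) ≤ t := by exact_mod_cast ht
    by_cases hcase : (1 - 1 / (2 * (d : ℝ))) ^ (((t : ℝ) - 1) / 2) ≤ 5 * δ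
    · refine (hrun.isPath ω).decrement_le_of_sum_le h (hrun.x_zero ω) (by positivity) ht (hω t) ?_
      calc _ ≤ 5 * δ * (5 / 4 * (d * (L / μ)) / δ) := by gcongr
        _ = 25 / 4 * (d * (L / μ)) := by field_simp; norm_num
        _ ≤ _ := by nlinarith [mul_pos (by linarith : (0 : ℝ) < d) hκ0]
    · -- in the early phase the claimed rate exceeds `1`, so that monotonicity of `λ` suffices
      obtain ⟨-, -, -, -, -, hmono, -⟩ := (hrun.isPath ω).step h (hrun.x_zero ω) t
      refine hmono.trans (le_mul_of_one_le_left hl0 ?_)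
      have hlt := not_le.1 hcase
      refine SharpenedBFGS.one_le_rate rfl hρ0 rfl ht (by positivity) ?_
      have h5 : 5 * δ * (8 * d * (L / μ)) = 4 * d * (1 + Real.log (L / μ)) := by
        rw [hδdef]; field_simp; norm_num
      have h6 : (t : ℝ) ≤ 4 * d * (1 + Real.log (L / μ)) := by
        have h7 := hlt.trans_le (SharpenedBFGS.rpow_half_le_exp rfl hρ0.le ht)
        have h8 : 1 / (2 * (L / μ)) ≤ 5 * δ := by
          rw [hδdef, div_le_iff₀ (by positivity)]
          have : 5 * ((1 + Real.log (L / μ)) / (10 * (L / μ))) * (2 * (L / μ))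
              = 1 + Real.log (L / μ) := by field_simp; norm_num
          linarith
        have h9 := Real.log_lt_log (by positivity) (h8.trans_lt h7)
        rw [Real.log_exp, one_div, Real.log_inv, neg_lt_neg_iff,
          Real.log_mul two_ne_zero hκ0.ne', div_lt_iff₀ (by positivity)] at h9
        have h10 := Real.log_two_lt_d9
        have h11 : (Real.log 2 + Real.log (L / μ)) * (4 * d)
            ≤ (0.75 + Real.log (L / μ)) * (4 * d) := by
          gcongr
          norm_num at h10 ⊢
          linarith
        norm_num at h11
        linarith
      calc (t : ℝ) ≤ 5 * δ * (8 * d * (L / μ)) := by rw [h5]; exact h6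
        _ ≤ _ := by gcongr
  · refine (hrun.le_measure_sum_contraction_sq_le h hδ).trans (measure_mono ?_)
    intro ω hω t ht
    have ht1 : (1 : ℝ) ≤ t := by exact_mod_cast ht
    refine ⟨(hrun.isPath ω).decrement_le_of_sum_le h (hrun.x_zero ω) (by positivity) ht (hω t) ?_,
      fun htδ => (hrun.isPath ω).decrement_le_of_sum_le h (hrun.x_zero ω) (by positivity) ht
        (hω t) ?_⟩
    · have h1 := Real.rpow_le_one hρ0.le hρ1 (z := ((t : ℝ) - 1) / 2) (by linarith)
      calc _ ≤ 1 * (5 / 4 * (d * (L / μ)) / δ) := by gcongr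
        _ = 5 / 4 / δ * d * (L / μ) := by ring
        _ ≤ _ := by gcongr; norm_num
    · have h1 : (1 - 1 / (2 * (d : ℝ))) ^ (((t : ℝ) - 1) / 2) ≤ δ := by
        refine (SharpenedBFGS.rpow_half_le_exp rfl hρ0.le ht).trans ?_
        rw [← Real.le_log_iff_exp_le hδ, neg_le, ← Real.log_inv, ← one_div,
          le_div_iff₀ (by positivity)]
        linarith
      calc _ ≤ δ * (5 / 4 * (d * (L / μ)) / δ) := by gcongr
        _ = 5 / 4 * (d * (L / μ)) := by field_simp
        _ ≤ _ := by nlinarith [mul_pos (by linarith : (0 : ℝ) < d) hκ0]
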